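/- Let $n\ge 1$, $m>0$ and $\omega_{\mathbf p}=\sqrt{|\mathbf p|^2+m^2}$ for $\mathbf p\in\mathbb R^n$. Use the Minkowski metric $(+,-,\dots,-)$, so that the covariant components of the on-shell momentum are $p_0=\omega_{\mathbf p}$, $p_j=-p^j$, and $p_kx^k=-\mathbf p\cdot\mathbf x$. Let $\mathscr F$ be the bosonic Fock space $\bigoplus_{k\ge0}\mathscr H_k^+$, where $\mathscr H_k^+$ is the space of symmetric functions of $k$ momenta that are square integrable with respect to $\prod_i d^n\mathbf p_i/(2\omega_{\mathbf p_i})$, and let $\mathscr D\subset\mathscr F$ be the subspace of vectors with finitely many non-zero components, all of them Schwartz functions. For $\Psi\in\mathscr D$ put $$(a(\mathbf p)\Psi)_k(\mathbf p_1,\dots,\mathbf p_k)=\frac{\sqrt{k+1}}{\sqrt{2\omega_{\mathbf p}}}\,\Psi_{k+1}(\mathbf p,\mathbf p_1,\dots,\mathbf p_k),\qquad \tilde a(\mathbf x)\Psi=(2\pi)^{-n/2}\int d^n\mathbf p\,e^{-ip_kx^k}a(\mathbf p)\Psi ,$$ and let $a^*(\mathbf p)$, $\tilde a^*(\mathbf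 x)$ be the adjoints in the sense of forms on $\mathscr D$. All integrals of products of these operators are understood in the sense of matrix elements: $T=\int d^ny\,A(y)^*B(y)$ means that $\langle\Phi,T\Psi\rangle=\int d^ny\,\langle A(y)\Phi,B(y)\Psi\rangle$, with absolutely convergent integral, for all $\Phi,\Psi\in\mathscr D$. Then the integral defining $\tilde a(\mathbf x)\Psi$ converges absolutely in $\mathscr F$ and $\mathbf x\mapsto\tilde a(\mathbf x)\Psi$ is differentiable for every $\Psi\in\mathscr D$, for each $\mu=0,\dots,n$ there is a unique linear operator $P_\mu:\mathscr D\to\mathscr F$ with $P_\mu=\int d^n\mathbf p\,p_\mu\,a^*(\mathbf p)a(\mathbf p)$, and these operators have the coordinate space representations $$P_0=\int d^n\mathbf x\,\tilde a^*(\mathbf x)\,(\tilde\omega*\tilde a)(\mathbf x),\qquad P_j=i\int d^n\mathbf x\,\tilde a^*(\mathbf x)\,\frac{\partial}{\partial x^j}\tilde a(\mathbf x)\quad(j=1,\dots,n),$$ where $$\tilde\omega(\mathbf x)=-2(2\pi)^{-\frac{n+1}2}\Big(\frac m{|\mathbf x|}\Big)^{\frac{n+1}2}K_{\frac{n+1}2}(m|\mathbf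 x|),$$ $K_\nu$ is the modified Bessel function of the second kind, and the convolution $(\tilde\omega*\tilde a)(\mathbf x)\Psi=\int d^n\mathbf y\,\tilde\omega(\mathbf x-\mathbf y)\,\tilde a(\mathbf y)\Psi$, whose kernel is singular like $|\mathbf x-\mathbf y|^{-(n+1)}$, is the Hadamard finite part: it is the limit in $\mathscr F$, as $\varepsilon\to0^+$, of the integral over $|\mathbf x-\mathbf y|>\varepsilon$ after subtraction of its divergent part, a linear combination of negative integer powers of $\varepsilon$ and $\log\varepsilon$ with coefficients in $\mathscr F$. -/

import Mathlib

open MeasureTheory Filter Topology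
open scoped SchwartzMap ENNReal

noncomputable section

namespace ScalarFock

/-! ### Kinematics -/

/-- Spatial momentum space, and also the spatial coordinate space, `ℝⁿ`; `p j` is the
contravariant component `p^j`. -/
abbrev Space (n : ℕ) := EuclideanSpace ℝ (Fin n)

/-- The relativistic energy `ω_p = √(|p|² + m²)`. -/
def energy {n : ℕ} (m : ℝ) (p : Space n) : ℝ := Real.sqrt (‖p‖ ^ 2 + m ^ 2)

/-- The covariant components `p_μ` of the on-shell momentum, with respect to the Minkowski
metric of signature `(+,-,…,-)`: `p_0 = ω_p` and `p_j = -p^j`. -/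
def covMomentum {n : ℕ} (m : ℝ) (p : Space n) : Fin (n + 1) → ℝ :=
  Fin.cons (energy m p) (fun j => -(p j))

/-- The contraction `p_k x^k` over the spatial indices (so it equals `-⟪p, x⟫`). -/
def spatialPairing {n : ℕ} (m : ℝ) (p x : Space n) : ℝ :=
  ∑ k : Fin n, covMomentum m p k.succ * x k

/-- The Lorentz-invariant measure `dⁿp / (2 ω_p)`. -/
def massShellMeasure (n : ℕ) (m : ℝ) : Measure (Space n) :=
  volume.withDensity (fun p => ENNReal.ofReal (1 / (2 * energy m p)))

/-- The measure of `k`-particle momentum space. -/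
abbrev kMeasure (n : ℕ) (m : ℝ) (k : ℕ) : Measure (Fin k → Space n) :=
  Measure.pi (fun _ => massShellMeasure n m)

instance instSigmaFiniteMassShell (n : ℕ) (m : ℝ) : SigmaFinite (massShellMeasure n m) := by
  unfold massShellMeasure
  exact SigmaFinite.withDensity_ofReal _

theorem continuous_energy {n : ℕ} (m : ℝ) : Continuous (energy m : Space n → ℝ) := by
  unfold energy
  fun_prop

theorem le_energy {n : ℕ} {m : ℝ} (p : Space n) : m ≤ energy m p :=
  Real.le_sqrt_of_sq_le (by nlinarith [sq_nonneg ‖p‖])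

theorem massShellMeasure_le {n : ℕ} {m : ℝ} (hm : 0 < m) :
    massShellMeasure n m ≤ ENNReal.ofReal (1 / (2 * m)) • volume := by
  rw [massShellMeasure, ← withDensity_const]
  refine withDensity_mono (Eventually.of_forall fun p => ?_)
  have := le_energy (m := m) p
  apply ENNReal.ofReal_le_ofReal
  gcongr

instance instTemperateMassShell (n : ℕ) (m : ℝ) [hm : Fact (0 < m)] :
    (massShellMeasure n m).HasTemperateGrowth := by
  obtain ⟨N, hN⟩ := (inferInstance : (volume : Measure (Space n)).HasTemperateGrowth)
  exact ⟨N, (hN.smul_measure ENNReal.ofReal_ne_top).mono_measure (massShellMeasure_le hm.out)⟩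

instance instTemperateK (n : ℕ) (m : ℝ) (k : ℕ) [hm : Fact (0 < m)] :
    (kMeasure n m k).HasTemperateGrowth := by
  obtain ⟨N, hN⟩ := instTemperateMassShell n m
  refine ⟨k * N, ?_⟩
  have h := Integrable.fintype_prod (ι := Fin k) (𝕜 := ℝ) (fun _ => hN)
  refine h.mono' (Measurable.aestronglyMeasurable (by fun_prop)) (Eventually.of_forall fun q => ?_)
  rw [Real.norm_of_nonneg (by positivity)]
  have : (1 + ‖q‖) ^ (-((k * N : ℕ) : ℝ)) = ∏ _i : Fin k, (1 + ‖q‖) ^ (-(N : ℝ)) := by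
    rw [Finset.prod_const, ← Real.rpow_natCast, ← Real.rpow_mul (by positivity)]
    congr 1
    simp
    ring
  rw [this]
  refine Finset.prod_le_prod (fun i _ => by positivity) (fun i _ => ?_)
  apply Real.rpow_le_rpow_of_nonpos (by positivity)
  · gcongr
    exact norm_le_pi_norm q i
  · simp

/-! ### The bosonic Fock space -/

theorem measurePreserving_perm (n : ℕ) (m : ℝ) (k : ℕ) (σ : Equiv.Perm (Fin k)) :
    MeasurePreserving (fun q : Fin k → Space n => q ∘ σ) (kMeasure n m k) (kMeasure n m k) := by
  have h := measurePreserving_piCongrLeft (fun _ : Fin k => massShellMeasure n m) σ.symm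
  convert h using 1
  funext q
  funext i
  have := Equiv.piCongrLeft_apply_apply (P := fun _ : Fin k => Space n) (e := σ.symm) q (σ i)
  simpa [MeasurableEquiv.coe_piCongrLeft] using this.symm

/-- The `k`-particle space: square integrable functions of `k` momenta, symmetric under all
permutations of the momenta. For `k = 0` this is a copy of `ℂ`. -/
def kParticleSpace (n : ℕ) (m : ℝ) (k : ℕ) : Submodule ℂ (Lp ℂ 2 (kMeasure n m k)) where
  carrier := {f | ∀ σ : Equiv.Perm (Fin k),
    Lp.compMeasurePreservingₗᵢ ℂ _ (measurePreserving_perm n m k σ) f = f}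
  zero_mem' σ := map_zero _
  add_mem' hf hg σ := by rw [map_add, hf σ, hg σ]
  smul_mem' c f hf σ := by rw [map_smul, hf σ]

instance instCompleteKParticle (n : ℕ) (m : ℝ) (k : ℕ) : CompleteSpace (kParticleSpace n m k) := by
  have : IsClosed (kParticleSpace n m k : Set (Lp ℂ 2 (kMeasure n m k))) := by
    have h : (kParticleSpace n m k : Set (Lp ℂ 2 (kMeasure n m k))) =
        ⋂ σ : Equiv.Perm (Fin k),
          {f | Lp.compMeasurePreservingₗᵢ ℂ _ (measurePreserving_perm n m k σ) f = f} := by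
      ext f
      simp [kParticleSpace]
    rw [h]
    exact isClosed_iInter fun σ => isClosed_eq (LinearIsometry.continuous _) continuous_id
  exact this.completeSpace_coe

/-- The bosonic Fock space: the Hilbert sum of the `k`-particle spaces. -/
def Fock (n : ℕ) (m : ℝ) : Type := lp (fun k : ℕ => kParticleSpace n m k) 2

instance instNormedAddCommGroupFock (n : ℕ) (m : ℝ) : NormedAddCommGroup (Fock n m) :=
  inferInstanceAs (NormedAddCommGroup (lp (fun k : ℕ => kParticleSpace n m k) 2))

instance instInnerProductSpaceFock (n : ℕ) (m : ℝ) : InnerProductSpace ℂ (Fock n m) :=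
  inferInstanceAs (InnerProductSpace ℂ (lp (fun k : ℕ => kParticleSpace n m k) 2))

instance instCompleteSpaceFock (n : ℕ) (m : ℝ) : CompleteSpace (Fock n m) :=
  inferInstanceAs (CompleteSpace (lp (fun k : ℕ => kParticleSpace n m k) 2))

/-! ### The domain of finite-particle Schwartz vectors -/

/-- Symmetric Schwartz functions of `k` momenta. -/
def symSchwartz (n k : ℕ) : Submodule ℂ 𝓢(Fin k → Space n, ℂ) where
  carrier := {f | ∀ (σ : Equiv.Perm (Fin k)) (q : Fin k → Space n), f (q ∘ σ) = f q}
  zero_mem' _ _ := rfl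
  add_mem' hf hg σ q := by simp [hf σ q, hg σ q]
  smul_mem' c f hf σ q := by simp [hf σ q]

/-- The domain of the operators: vectors with finitely many non-zero components, all of them
Schwartz functions. -/
abbrev Dom (n : ℕ) := Π₀ k : ℕ, symSchwartz n k

/-- A symmetric Schwartz function as an element of the `k`-particle space. -/
def toKParticle (n : ℕ) (m : ℝ) [Fact (0 < m)] (k : ℕ) :
    symSchwartz n k →ₗ[ℂ] kParticleSpace n m k :=
  ((SchwartzMap.toLpCLM ℂ ℂ 2 (kMeasure n m k)).toLinearMap ∘ₗ (symSchwartz n k).subtype).codRestrict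
    (kParticleSpace n m k) (by
      intro f σ
      change Lp.compMeasurePreserving _ (measurePreserving_perm n m k σ)
        ((f.1.memLp 2 (kMeasure n m k)).toLp) = (f.1.memLp 2 (kMeasure n m k)).toLp
      rw [Lp.toLp_compMeasurePreserving]
      congr 1
      funext q
      exact f.2 σ q)

/-- The inclusion of the domain into the Fock space. -/
def toFock {n : ℕ} (m : ℝ) [Fact (0 < m)] : Dom n →ₗ[ℂ] Fock n m where
  toFun Ψ := show lp (fun k : ℕ => kParticleSpace n m k) 2 from ⟨fun k => toKParticle n m k (Ψ k), by
    refine (memℓp_zero ?_).of_exponent_ge (zero_le (a := (2 : ℝ≥0∞)))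
    refine Ψ.finite_support.subset fun k hk h0 => hk ?_
    rw [h0, map_zero]⟩
  map_add' Φ Ψ := by
    refine Subtype.ext (funext fun k => ?_)
    exact map_add (toKParticle n m k) (Φ k) (Ψ k)
  map_smul' c Ψ := by
    refine Subtype.ext (funext fun k => ?_)
    exact map_smul (toKParticle n m k) c (Ψ k)

/-! ### Ladder operators with sharp momentum -/

theorem cons_temperate {n k : ℕ} (p : Space n) :
    Function.HasTemperateGrowth (fun q : Fin k → Space n => (Fin.cons p q : Fin (k + 1) → Space n)) := by
  have h : (fun q : Fin k → Space n => (Fin.cons p q : Fin (k + 1) → Space n)) =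
      fun q => (ContinuousLinearMap.pi (fun i : Fin (k + 1) =>
        Fin.cases (motive := fun _ => (Fin k → Space n) →L[ℝ] Space n) 0
          (fun j => ContinuousLinearMap.proj j) i)) q + Fin.cons p 0 := by
    funext q i
    refine Fin.cases ?_ (fun j => ?_) i <;> simp
  rw [h]
  exact (ContinuousLinearMap.hasTemperateGrowth _).add (Function.HasTemperateGrowth.const _)

theorem cons_upper {n k : ℕ} (p : Space n) : ∃ (N : ℕ) (C : ℝ), ∀ q : Fin k → Space n,
    ‖q‖ ≤ C * (1 + ‖(Fin.cons p q : Fin (k + 1) → Space n)‖) ^ N := by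
  refine ⟨1, 1, fun q => ?_⟩
  rw [pow_one, one_mul]
  refine (pi_norm_le_iff_of_nonneg (by positivity)).2 fun i => ?_
  have := norm_le_pi_norm (Fin.cons p q : Fin (k + 1) → Space n) i.succ
  rw [Fin.cons_succ] at this
  linarith

/-- The partial evaluation `f ↦ f(p, ·, …, ·)`. -/
def slice {n : ℕ} (k : ℕ) (p : Space n) : symSchwartz n (k + 1) →ₗ[ℂ] symSchwartz n k :=
  ((SchwartzMap.compCLM ℂ (cons_temperate p) (cons_upper p)).toLinearMap ∘ₗ
    (symSchwartz n (k + 1)).subtype).codRestrict (symSchwartz n k) (by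
      intro f σ q
      have h := f.2 (Equiv.Perm.decomposeFin.symm (0, σ)) (Fin.cons p q)
      have e : (Fin.cons p q : Fin (k + 1) → Space n) ∘ (Equiv.Perm.decomposeFin.symm (0, σ)) =
          Fin.cons p (q ∘ σ) := by
        funext i
        refine Fin.cases ?_ (fun j => ?_) i <;> simp
      rw [e] at h
      exact h)

/-- The covariant annihilation operator with sharp momentum,
`(a_c(p)Ψ)_k(p₁,…,p_k) = √(k+1) Ψ_{k+1}(p,p₁,…,p_k)`. Integrating it against
`conj f(p) dⁿp/(2ω_p)` yields the smeared operator `a_c(f)`. -/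
def annihilationCov {n : ℕ} (p : Space n) : Dom n →ₗ[ℂ] Dom n where
  toFun Ψ := DFinsupp.mapRange (fun k f => ((Real.sqrt (k + 1) : ℝ) : ℂ) • slice k p f)
    (fun k => by simp) (DFinsupp.comapDomain Nat.succ Nat.succ_injective Ψ)
  map_add' Φ Ψ := by
    ext k : 1
    simp [DFinsupp.mapRange_apply]
  map_smul' c Ψ := by
    ext k : 1
    simp [DFinsupp.mapRange_apply, smul_comm c]

/-- The annihilation operator `a(p) = a_c(p) / √(2 ω_p)` in non-covariant normalization, as an
operator from the domain into the Fock space. -/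
def annihilation {n : ℕ} (m : ℝ) [Fact (0 < m)] (p : Space n) : Dom n →ₗ[ℂ] Fock n m :=
  ((1 / Real.sqrt (2 * energy m p) : ℝ) : ℂ) • (toFock m ∘ₗ annihilationCov p)

/-- The integrand `e^{-i p_k x^k} a(p)Ψ` of the Fourier transform. -/
def fourierIntegrand {n : ℕ} (m : ℝ) [Fact (0 < m)] (x : Space n) (Ψ : Dom n) (p : Space n) :
    Fock n m :=
  Complex.exp (-Complex.I * (spatialPairing m p x : ℂ)) • annihilation m p Ψ

/-- The annihilation operator in coordinate space,
`ã(x) = (2π)^{-n/2} ∫ dⁿp e^{-i p_k x^k} a(p)`. -/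
def coordAnnihilation {n : ℕ} (m : ℝ) [Fact (0 < m)] (x : Space n) (Ψ : Dom n) : Fock n m :=
  (((2 * Real.pi) ^ (-(n : ℝ) / 2) : ℝ) : ℂ) • ∫ p, fourierIntegrand m x Ψ p

/-! ### Integrals of products of ladder operators -/

/-- `T = ∫ dⁿy A(y)* B(y)` for families `A`, `B` of operators from the domain into the Fock space.
As usual for operator-valued distributions, `A(y)*` is the form adjoint
`⟨Φ, A(y)* χ⟩ = ⟨A(y)Φ, χ⟩`, and the integral is understood in the sense of matrix elements between
vectors of the domain. -/
def IsOperatorIntegral {n : ℕ} {m : ℝ} [Fact (0 < m)] (T : Dom n →ₗ[ℂ] Fock n m)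
    (A B : Space n → Dom n → Fock n m) : Prop :=
  ∀ Φ Ψ : Dom n, Integrable (fun y => inner ℂ (A y Φ) (B y Ψ)) ∧
    inner ℂ (toFock m Φ) (T Ψ) = ∫ y, inner ℂ (A y Φ) (B y Ψ)

/-- `T` is the second-quantized momentum `P_μ = ∫ dⁿp p_μ a*(p) a(p)`. -/
def IsMomentumOperator {n : ℕ} {m : ℝ} [Fact (0 < m)] (μ : Fin (n + 1))
    (T : Dom n →ₗ[ℂ] Fock n m) : Prop :=
  IsOperatorIntegral T (fun p => annihilation m p)
    (fun p Ψ => (covMomentum m p μ : ℂ) • annihilation m p Ψ)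

/-! ### The kernel and the convolution -/

/-- The modified Bessel function of the second kind,
`K_ν(z) = ∫_0^∞ e^{-z cosh t} cosh(ν t) dt` for `z > 0`. -/
def besselK (ν z : ℝ) : ℝ :=
  ∫ t in Set.Ioi (0 : ℝ), Real.exp (-z * Real.cosh t) * Real.cosh (ν * t)

/-- The kernel `ω̃(x) = -2 (2π)^{-(n+1)/2} (m/|x|)^{(n+1)/2} K_{(n+1)/2}(m|x|)`, `x ≠ 0`. -/
def omegaTilde {n : ℕ} (m : ℝ) (x : Space n) : ℝ :=
  -2 * (2 * Real.pi) ^ (-((n : ℝ) + 1) / 2) * (m / ‖x‖) ^ (((n : ℝ) + 1) / 2) *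
    besselK (((n : ℝ) + 1) / 2) (m * ‖x‖)

/-- `v` is the value at `x` of the convolution `κ ∗ f`, for a kernel `κ` that may have a
non-integrable singularity at the origin. The integral `∫ κ(x-y) f(y) dy` is a Hadamard finite part:
the integral over `|x-y| > ε` equals a combination of negative powers of `ε` and of `log ε`, plus a
term that tends to `v` as `ε → 0+`. (If `y ↦ κ(x-y) f(y)` is integrable, `v` is its integral.) -/
def HasConvolution {n : ℕ} {F : Type*} [NormedAddCommGroup F] [NormedSpace ℝ F]
    (κ : Space n → ℝ) (f : Space n → F) (x : Space n) (v : F) : Prop :=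
  (∀ ε : ℝ, 0 < ε → IntegrableOn (fun y => κ (x - y) • f y) {y | ε < ‖x - y‖}) ∧
  ∃ (N : ℕ) (c : Fin N → F) (d : F),
    Tendsto (fun ε : ℝ => (∫ y in {y | ε < ‖x - y‖}, κ (x - y) • f y) -
        ((∑ i : Fin N, (1 / ε ^ ((i : ℕ) + 1)) • c i) + Real.log ε • d))
      (𝓝[>] 0) (𝓝 v)

/-- The partial derivative `∂f/∂x^j`. -/
def partialDeriv {n : ℕ} {F : Type*} [NormedAddCommGroup F] [NormedSpace ℝ F]
    (j : Fin n) (f : Space n → F) (x : Space n) : F :=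
  fderiv ℝ f x (EuclideanSpace.single j 1)

end ScalarFock

end

open ScalarFock

/-! For Ψ in the domain, `p ↦ annihilation m p Ψ` is a continuous, rapidly decaying function with
values in the Hilbert space `Fock n m` (`rapidDecay_annihilation`). Since p_k x^k = -p·x,
`coordAnnihilation` is its unitary Fourier transform (`coordAnnihilation_eq`). Vector-valued
Plancherel (`integral_inner_waveTransform`) carries matrix elements from momentum to coordinate
space, so it remains to see which coordinate operation corresponds to multiplication by p_μ. For μ =
j it is i∂_j: differentiation produces i p^j, and i·i p^j = -p^j = p_j.

For μ = 0 it is convolution with ω̃. The starting point is 2√π ω = ∫₀^∞ s^{-3/2} (1 - e^{-sω²}) ds.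
Because e^{-s|p|²} is the cosine transform of the heat kernel h_s, which has mass 1, 2√π ω(p) = ∫∫
s^{-3/2} h_s(y) (1 - e^{-sm²} cos p·y) dy ds, an absolutely convergent integral
(`integral_compensated`). By Macdonald's formula, s-integration of s^{-3/2} e^{-sm²} h_s(y) gives
-2√π ω̃(y) (`omegaTilde_eq_integral`). On |y| > ε the two terms can be separated: the term 1 is
exactly a constant over ε by scaling, and the other is the symbol of the truncated kernel. That
symbol minus its 1/ε part therefore tends to ω(p), with an ε-independent bound C(1 + |p|²)
(`truncatedSymbol_sub`, `exists_truncatedSymbol_bound`). Dominated convergence against the rapidly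
decaying amplitude gives the finite part (`hasConvolution_waveTransform`).

The operator P_μ is multiplication by the total momentum on each k-particle component. Bose symmetry
makes all k + 1 summands contribute equally, which matches the two factors √(k+1) from the
annihilation operators (`inner_momentumOperator`). Uniqueness holds because symmetrized Schwartz
functions separate Fock vectors (`eq_of_inner_toFock`). -/

noncomputable section

namespace ScalarFock

open FourierTransform

/-! ### Plancherel's theorem for Hilbert-space-valued functions in L¹ ∩ L². -/

section Plancherel

variable {E F : Type*} [NormedAddCommGroup E] [InnerProductSpace ℝ E] [FiniteDimensional ℝ E]
  [MeasurableSpace E] [BorelSpace E] [NormedAddCommGroup F] [InnerProductSpace ℂ F]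

/-- The Fourier integral of an integrable function is continuous. -/
theorem continuous_fourier_of_integrable {g : E → F} (hg : Integrable g) :
    Continuous (𝓕 g) :=
  VectorFourier.fourierIntegral_continuous Real.continuous_fourierChar continuous_inner hg

/-- On `L¹ ∩ L²` the `L²` Fourier transform is given by the Fourier integral. -/
theorem fourier_toLp_ae_eq [CompleteSpace F] {g : E → F} (hg : Integrable g) (hg2 : MemLp g 2) :
    𝓕 g =ᵐ[volume] (𝓕 (hg2.toLp g) : Lp F 2 (volume : Measure E)) := by
  -- Both sides are locally integrable, so testing against smooth compactly supported φ suffices.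
  -- For the L² transform the pairing is moved onto φ by the tempered distribution identity, for the
  -- Fourier integral by Fubini.
  refine ae_eq_of_integral_contDiff_smul_eq (continuous_fourier_of_integrable hg).locallyIntegrable
    ((Lp.memLp _).locallyIntegrable (by norm_num)) fun φ hφ hφc => ?_
  have hsm : ContDiff ℝ (⊤ : ℕ∞) (fun x => (φ x : ℂ)) := Complex.ofRealCLM.contDiff.comp hφ
  have hcs : HasCompactSupport (fun x => (φ x : ℂ)) := hφc.comp_left (g := Complex.ofReal) rfl
  set ψ : 𝓢(E, ℂ) := hcs.toSchwartzMap hsm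
  have hψ : ∀ x, ψ x = (φ x : ℂ) := fun x => rfl
  have h1 := congrArg (fun T => T ψ) (Lp.fourier_toTemperedDistribution_eq (hg2.toLp g))
  simp only [TemperedDistribution.fourier_apply, Lp.toTemperedDistribution_apply] at h1
  have h2 : ∫ x, φ x • 𝓕 g x = ∫ x, (𝓕 ψ) x • g x := by
    have := VectorFourier.integral_fourierIntegral_smul_eq_flip (μ := volume) (ν := volume)
      (L := innerₗ E) (f := ψ) (g := g) Real.continuous_fourierChar continuous_inner
      ψ.integrable hg
    rw [flip_innerₗ] at this
    rw [SchwartzMap.fourier_coe]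
    exact this.symm
  rw [h2]
  refine Eq.trans (integral_congr_ae ?_) h1
  filter_upwards [hg2.coeFn_toLp] with x hx
  rw [hx]

/-- Plancherel's theorem for Fourier integrals of functions in `L¹ ∩ L²`. -/
theorem integral_inner_fourier_of_memLp [CompleteSpace F] {f g : E → F}
    (hf : Integrable f) (hf2 : MemLp f 2) (hg : Integrable g) (hg2 : MemLp g 2) :
    Integrable (fun x => inner ℂ (𝓕 f x) (𝓕 g x)) ∧
      ∫ x, inner ℂ (𝓕 f x) (𝓕 g x) = ∫ x, inner ℂ (f x) (g x) := by
  have hF := fourier_toLp_ae_eq hf hf2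
  have hG := fourier_toLp_ae_eq hg hg2
  have key : (fun x => inner ℂ ((𝓕 (hf2.toLp f) : Lp F 2 (volume : Measure E)) x)
      ((𝓕 (hg2.toLp g) : Lp F 2 (volume : Measure E)) x)) =ᵐ[volume]
      fun x => inner ℂ (𝓕 f x) (𝓕 g x) := by
    filter_upwards [hF, hG] with x h1 h2
    rw [h1, h2]
  refine ⟨(L2.integrable_inner _ _).congr key, ?_⟩
  rw [← integral_congr_ae key, ← L2.inner_def, Lp.inner_fourier_eq, L2.inner_def]
  refine integral_congr_ae ?_
  filter_upwards [hf2.coeFn_toLp, hg2.coeFn_toLp] with x h1 h2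
  rw [h1, h2]

end Plancherel

/-! ### The Fourier transform in the plane wave normalization: unitarity and derivatives. -/

section WaveTransform

variable {n : ℕ} {F : Type*} [NormedAddCommGroup F] [InnerProductSpace ℂ F]

/-- The superposition `(2π)^{-n/2} ∫ dⁿp e^{i p·x} g(p)` of plane waves with amplitude `g`. -/
def waveTransform (g : Space n → F) (x : Space n) : F :=
  (((2 * Real.pi) ^ (-(n : ℝ) / 2) : ℝ) : ℂ) •
    ∫ p, Complex.exp (Complex.I * (inner ℝ p x : ℝ)) • g p

theorem integrable_planeWave_smul {g : Space n → F} (hg : Integrable g) (x : Space n) :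
    Integrable (fun p => Complex.exp (Complex.I * (inner ℝ p x : ℝ)) • g p) := by
  refine hg.bdd_smul 1 (Continuous.aestronglyMeasurable (by fun_prop))
    (Eventually.of_forall fun p => ?_)
  simp [Complex.norm_exp]

theorem waveTransform_sub {f g : Space n → F} (hf : Integrable f) (hg : Integrable g)
    (x : Space n) :
    waveTransform (fun p => f p - g p) x = waveTransform f x - waveTransform g x := by
  simp only [waveTransform, smul_sub]
  rw [integral_sub (integrable_planeWave_smul hf x) (integrable_planeWave_smul hg x), smul_sub]

theorem waveTransform_const_smul (c : ℂ) (g : Space n → F) (x : Space n) :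
    waveTransform (fun p => c • g p) x = c • waveTransform g x := by
  simp only [waveTransform, smul_comm _ c]
  rw [integral_smul, smul_comm]

/-- The character of `𝓕` is e^{-2πi p·y}, so the substitution y = -x/(2π) gives e^{i p·x}.
Continuity, Plancherel and differentiability are imported through this rescaling. -/
theorem waveTransform_eq_fourier (g : Space n → F) (x : Space n) :
    waveTransform g x = (((2 * Real.pi) ^ (-(n : ℝ) / 2) : ℝ) : ℂ) •
      𝓕 g ((-(2 * Real.pi)⁻¹ : ℝ) • x) := by
  rw [waveTransform, Real.fourier_eq]
  congr 1
  refine integral_congr_ae (Eventually.of_forall fun p => ?_)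
  simp only [Circle.smul_def, Real.fourierChar_apply, inner_smul_right]
  congr 2
  push_cast
  have : (Real.pi : ℂ) ≠ 0 := by exact_mod_cast Real.pi_ne_zero
  field_simp

theorem continuous_waveTransform {g : Space n → F} (hg : Integrable g) :
    Continuous (waveTransform g) := by
  simp_rw [funext (waveTransform_eq_fourier g)]
  exact ((continuous_fourier_of_integrable hg).comp (continuous_const_smul _)).const_smul _

theorem norm_waveTransform_le (g : Space n → F) (x : Space n) :
    ‖waveTransform g x‖ ≤ (2 * Real.pi) ^ (-(n : ℝ) / 2) * ∫ p, ‖g p‖ := by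
  rw [waveTransform, norm_smul, Complex.norm_real, Real.norm_of_nonneg (by positivity)]
  gcongr
  refine (norm_integral_le_integral_norm _).trans_eq ?_
  simp [norm_smul, Complex.norm_exp]

/-- The wave transform is unitary. -/
theorem integral_inner_waveTransform [CompleteSpace F] {f g : Space n → F}
    (hf : Integrable f) (hf2 : MemLp f 2) (hg : Integrable g) (hg2 : MemLp g 2) :
    Integrable (fun x => inner ℂ (waveTransform f x) (waveTransform g x)) ∧
      ∫ x, inner ℂ (waveTransform f x) (waveTransform g x) = ∫ x, inner ℂ (f x) (g x) := by
  obtain ⟨h1, h2⟩ := integral_inner_fourier_of_memLp hf hf2 hg hg2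
  have hpi : (-(2 * Real.pi)⁻¹ : ℝ) ≠ 0 := by simp [Real.pi_ne_zero]
  have e : (fun x : Space n => (inner ℂ (waveTransform f x) (waveTransform g x) : ℂ)) =
      fun x => ((((2 * Real.pi) ^ (-(n : ℝ)) : ℝ)) : ℂ) •
        (fun y => inner ℂ (𝓕 f y) (𝓕 g y)) ((-(2 * Real.pi)⁻¹ : ℝ) • x) := by
    funext x
    rw [waveTransform_eq_fourier, waveTransform_eq_fourier, inner_smul_left, inner_smul_right,
      Complex.conj_ofReal, ← mul_assoc, ← Complex.ofReal_mul,
      ← Real.rpow_add Real.two_pi_pos, smul_eq_mul]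
    congr 3
    ring_nf
  rw [e]
  refine ⟨(h1.comp_smul hpi).const_mul _, ?_⟩
  -- The Jacobian (2π)^n of the rescaling cancels the square of the prefactor (2π)^{-n/2}.
  have hc : (2 * Real.pi) ^ (-(n : ℝ)) * |((-(2 * Real.pi)⁻¹ : ℝ) ^ n)⁻¹| = 1 := by
    rw [abs_inv, abs_pow, abs_neg, abs_of_pos (by positivity), inv_pow, inv_inv,
      Real.rpow_neg (by positivity), Real.rpow_natCast, inv_mul_cancel₀ (by positivity)]
  rw [integral_smul, Measure.integral_comp_smul volume (fun y => inner ℂ (𝓕 f y) (𝓕 g y)), h2,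
    finrank_euclideanSpace, Fintype.card_fin,
    Complex.real_smul, smul_eq_mul, ← mul_assoc, ← Complex.ofReal_mul, hc, Complex.ofReal_one,
    one_mul]

theorem fderiv_waveTransform [CompleteSpace F] {g : Space n → F} (hg : Integrable g)
    (hg1 : Integrable (fun p => ‖p‖ * ‖g p‖)) (x : Space n) :
    DifferentiableAt ℝ (waveTransform g) x ∧ ∀ v, fderiv ℝ (waveTransform g) x v =
      waveTransform (fun p => (Complex.I * (inner ℝ p v : ℝ)) • g p) x := by
  have h := Real.hasFDerivAt_fourier hg hg1 ((-(2 * Real.pi)⁻¹ : ℝ) • x)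
  have h2 := (h.comp x ((hasFDerivAt_id x).const_smul (-(2 * Real.pi)⁻¹ : ℝ))).const_smul
    (((2 * Real.pi) ^ (-(n : ℝ) / 2) : ℝ) : ℂ)
  have h3 : HasFDerivAt (waveTransform g) _ x :=
    h2.congr_of_eventuallyEq (Eventually.of_forall fun y => waveTransform_eq_fourier g y)
  refine ⟨h3.differentiableAt, fun v => ?_⟩
  rw [h3.fderiv, waveTransform_eq_fourier]
  -- The derivative is the transform of an operator-valued function. Its integrability allows
  -- evaluation at `v` to be taken inside the integral.
  have hi : Integrable (VectorFourier.fourierSMulRight (innerSL ℝ) g) := by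
    refine (hg1.const_mul (2 * Real.pi * ‖innerSL ℝ (E := Space n)‖)).mono'
      hg.1.fourierSMulRight (Eventually.of_forall fun p => ?_)
    refine (VectorFourier.norm_fourierSMulRight_le _ _ _).trans_eq ?_
    ring
  have e := Real.fourier_continuousLinearMap_apply hi (a := v)
    (v := (-(2 * Real.pi)⁻¹ : ℝ) • x)
  simp only [smul_apply, ContinuousLinearMap.comp_apply, ContinuousLinearMap.id_apply]
  simp only [map_smul]
  rw [e, Real.fourier_eq, Real.fourier_eq, ← integral_smul]
  congr 1
  refine integral_congr_ae (Eventually.of_forall fun p => ?_)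
  have : (Real.pi : ℂ) ≠ 0 := by exact_mod_cast Real.pi_ne_zero
  simp only [VectorFourier.fourierSMulRight_apply, Circle.smul_def,
    ← Complex.coe_smul (_ : ℝ) (_ : F), smul_smul]
  congr 1
  push_cast
  field_simp
  rfl

end WaveTransform

section Kernel

/-! ### Heat kernel representation of the energy -/

/-- The heat kernel `(4πs)^{-n/2} e^{-|y|²/(4s)}` on `ℝⁿ`. -/
def heatKernel {n : ℕ} (s : ℝ) (y : Space n) : ℝ :=
  (4 * Real.pi * s) ^ (-(n : ℝ) / 2) * Real.exp (-(4 * s)⁻¹ * ‖y‖ ^ 2)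

variable {n : ℕ}

theorem heatKernel_nonneg {s : ℝ} (hs : 0 < s) (y : Space n) : 0 ≤ heatKernel s y := by
  unfold heatKernel; positivity

theorem measurable_heatKernel :
    Measurable (fun z : ℝ × Space n => heatKernel z.1 z.2) := by
  unfold heatKernel; fun_prop

theorem integral_heatKernel_mul_cexp {s : ℝ} (hs : 0 < s) (p : Space n) :
    Integrable (fun y : Space n =>
      (heatKernel s y : ℂ) * Complex.exp (Complex.I * (inner ℝ p y : ℝ))) ∧
    ∫ y : Space n, (heatKernel s y : ℂ) * Complex.exp (Complex.I * (inner ℝ p y : ℝ)) =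
      (Real.exp (-s * ‖p‖ ^ 2) : ℝ) := by
  have hb : 0 < (((4 * s)⁻¹ : ℝ) : ℂ).re := by rw [Complex.ofReal_re]; positivity
  have e : (fun y : Space n => (heatKernel s y : ℂ) * Complex.exp (Complex.I * (inner ℝ p y : ℝ))) =
      fun y => (((4 * Real.pi * s) ^ (-(n : ℝ) / 2) : ℝ) : ℂ) *
        Complex.exp (-(((4 * s)⁻¹ : ℝ) : ℂ) * ‖y‖ ^ 2 + Complex.I * (inner ℝ p y : ℝ)) := by
    funext y
    rw [heatKernel, Complex.exp_add]
    push_cast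
    ring
  rw [e]
  refine ⟨(GaussianFourier.integrable_cexp_neg_mul_sq_norm_add hb Complex.I p).const_mul _, ?_⟩
  rw [integral_const_mul, GaussianFourier.integral_cexp_neg_mul_sq_norm_add hb Complex.I p,
    finrank_euclideanSpace, Fintype.card_fin]
  have h1 : ((Real.pi : ℂ) / (((4 * s)⁻¹ : ℝ) : ℂ)) ^ ((n : ℂ) / 2) =
      (((4 * Real.pi * s) ^ ((n : ℝ) / 2) : ℝ) : ℂ) := by
    rw [Complex.ofReal_cpow (by positivity)]
    push_cast
    congr 1
    field_simp
  have h2 : Complex.exp (Complex.I ^ 2 * ‖p‖ ^ 2 / (4 * (((4 * s)⁻¹ : ℝ) : ℂ))) =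
      (Real.exp (-s * ‖p‖ ^ 2) : ℝ) := by
    push_cast
    rw [Complex.I_sq]
    congr 1
    field_simp
  rw [h1, h2, ← mul_assoc, ← Complex.ofReal_mul, ← Real.rpow_add (by positivity), neg_div,
    neg_add_cancel, Real.rpow_zero, Complex.ofReal_one, one_mul]

theorem integrable_heatKernel {s : ℝ} (hs : 0 < s) : Integrable (heatKernel s : Space n → ℝ) := by
  have := (integral_heatKernel_mul_cexp hs (0 : Space n)).1.re
  simpa using this

theorem integral_heatKernel {s : ℝ} (hs : 0 < s) : ∫ y : Space n, heatKernel s y = 1 := by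
  have := (integral_heatKernel_mul_cexp hs (0 : Space n)).2
  simp only [inner_zero_left, Complex.ofReal_zero, mul_zero, Complex.exp_zero, mul_one, norm_zero,
    ne_eq, OfNat.ofNat_ne_zero, not_false_eq_true, zero_pow, Real.exp_zero] at this
  exact_mod_cast this

theorem integral_heatKernel_mul_cos {s : ℝ} (hs : 0 < s) (p : Space n) :
    ∫ y : Space n, heatKernel s y * Real.cos (inner ℝ p y) = Real.exp (-s * ‖p‖ ^ 2) := by
  obtain ⟨h1, h2⟩ := integral_heatKernel_mul_cexp hs p
  have := congrArg Complex.re h2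
  rw [← RCLike.re_eq_complex_re, ← integral_re h1] at this
  simp only [RCLike.re_eq_complex_re, Complex.ofReal_re, Complex.re_ofReal_mul] at this
  rw [← this]
  refine integral_congr_ae (Eventually.of_forall fun y => ?_)
  simp only
  rw [mul_comm Complex.I, Complex.exp_ofReal_mul_I_re]

/-- Half of the Gaussian exponent absorbs |y|², since u ≤ e^u with u = |y|²/(8s); the other half is
a Gaussian at time 2s. The factor s gained turns the weight s^{-3/2} into the integrable s^{-1/2}
near s = 0. -/
theorem norm_sq_mul_heatKernel_le {s : ℝ} (hs : 0 < s) (y : Space n) :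
    ‖y‖ ^ 2 * heatKernel s y ≤ 8 * 2 ^ ((n : ℝ) / 2) * s * heatKernel (2 * s) y := by
  unfold heatKernel
  have h1 : (4 * Real.pi * (2 * s)) ^ (-(n : ℝ) / 2) =
      2 ^ (-((n : ℝ) / 2)) * (4 * Real.pi * s) ^ (-(n : ℝ) / 2) := by
    rw [show 4 * Real.pi * (2 * s) = 2 * (4 * Real.pi * s) by ring,
      Real.mul_rpow (by norm_num) (by positivity), neg_div]
  have h2 : ‖y‖ ^ 2 * Real.exp (-(4 * s)⁻¹ * ‖y‖ ^ 2) ≤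
      8 * s * Real.exp (-(4 * (2 * s))⁻¹ * ‖y‖ ^ 2) := by
    have e : -(4 * s)⁻¹ * ‖y‖ ^ 2 = -((8 * s)⁻¹ * ‖y‖ ^ 2) + -((8 * s)⁻¹ * ‖y‖ ^ 2) := by
      field_simp; ring
    have e2 : -(4 * (2 * s))⁻¹ * ‖y‖ ^ 2 = -((8 * s)⁻¹ * ‖y‖ ^ 2) := by
      field_simp; ring
    rw [e, e2, Real.exp_add, ← mul_assoc]
    refine mul_le_mul_of_nonneg_right ?_ (Real.exp_nonneg _)
    have := Real.add_one_le_exp ((8 * s)⁻¹ * ‖y‖ ^ 2)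
    rw [Real.exp_neg, ← div_eq_mul_inv, div_le_iff₀ (Real.exp_pos _)]
    calc ‖y‖ ^ 2 = 8 * s * ((8 * s)⁻¹ * ‖y‖ ^ 2) := by field_simp
      _ ≤ _ := by gcongr; linarith
  have h3 : (2 : ℝ) ^ ((n : ℝ) / 2) * 2 ^ (-((n : ℝ) / 2)) = 1 := by
    rw [← Real.rpow_add (by norm_num), add_neg_cancel, Real.rpow_zero]
  calc _ = (4 * Real.pi * s) ^ (-(n : ℝ) / 2) * (‖y‖ ^ 2 * Real.exp (-(4 * s)⁻¹ * ‖y‖ ^ 2)) := by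
        ring
    _ ≤ (4 * Real.pi * s) ^ (-(n : ℝ) / 2) *
        (8 * s * Real.exp (-(4 * (2 * s))⁻¹ * ‖y‖ ^ 2)) := by gcongr
    _ = ((2 : ℝ) ^ ((n : ℝ) / 2) * 2 ^ (-((n : ℝ) / 2))) * ((4 * Real.pi * s) ^ (-(n : ℝ) / 2) *
        (8 * s * Real.exp (-(4 * (2 * s))⁻¹ * ‖y‖ ^ 2))) := by rw [h3, one_mul]
    _ = _ := by rw [h1]; ring

/-- Near 0 the bound 1 - e^{-sA} ≤ sA leaves s^{-1/2}; on (1, ∞) the power s^{-3/2} is integrable by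
itself. -/
theorem integrable_rpow_mul_one_sub_exp {A : ℝ} (hA : 0 ≤ A) :
    IntegrableOn (fun s : ℝ => s ^ (-(3 / 2) : ℝ) * (1 - Real.exp (-s * A))) (Set.Ioi 0) := by
  have hm : Measurable (fun s : ℝ => s ^ (-(3 / 2) : ℝ) * (1 - Real.exp (-s * A))) := by fun_prop
  rw [← Set.Ioc_union_Ioi_eq_Ioi zero_le_one]
  refine IntegrableOn.union ?_ ?_
  · have h : IntegrableOn (fun s : ℝ => s ^ (-(1 / 2) : ℝ)) (Set.Ioc 0 1) :=
      (intervalIntegrable_iff_integrableOn_Ioc_of_le zero_le_one).1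
        (intervalIntegral.intervalIntegrable_rpow' (by norm_num))
    refine (h.mul_const A).mono' hm.aestronglyMeasurable ?_
    filter_upwards [ae_restrict_mem measurableSet_Ioc] with s hs
    have hs0 : 0 < s := hs.1
    have h1 : Real.exp (-s * A) ≤ 1 := Real.exp_le_one_iff.2 (by nlinarith)
    have h2 := Real.add_one_le_exp (-s * A)
    rw [Real.norm_of_nonneg (mul_nonneg (by positivity) (by linarith))]
    calc s ^ (-(3 / 2) : ℝ) * (1 - Real.exp (-s * A)) ≤ s ^ (-(3 / 2) : ℝ) * (s ^ (1 : ℝ) * A) := by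
          gcongr; rw [Real.rpow_one]; linarith
      _ = _ := by rw [← mul_assoc, ← Real.rpow_add hs0]; norm_num
  · have h : IntegrableOn (fun s : ℝ => s ^ (-(3 / 2) : ℝ)) (Set.Ioi 1) :=
      integrableOn_Ioi_rpow_of_lt (by norm_num) zero_lt_one
    refine h.mono' hm.aestronglyMeasurable ?_
    filter_upwards [ae_restrict_mem measurableSet_Ioi] with s hs
    have hs0 : 0 < s := zero_lt_one.trans hs
    have h1 : Real.exp (-s * A) ≤ 1 := Real.exp_le_one_iff.2 (by nlinarith)
    rw [Real.norm_of_nonneg (mul_nonneg (by positivity) (by linarith))]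
    have := Real.exp_pos (-s * A)
    exact mul_le_of_le_one_right (by positivity) (by linarith)

theorem integrable_rpow_mul_exp {A : ℝ} (hA : 0 < A) :
    IntegrableOn (fun s : ℝ => s ^ (-(1 / 2) : ℝ) * Real.exp (-s * A)) (Set.Ioi 0) := by
  have := integrableOn_rpow_mul_exp_neg_mul_rpow (p := 1) (s := -(1 / 2)) (b := A) (by norm_num)
    (by norm_num) hA
  refine this.congr_fun (fun s _ => ?_) measurableSet_Ioi
  simp only [Real.rpow_one]
  ring_nf

/-- Integration by parts with the boundary function -2 s^{-1/2} (1 - e^{-sA}), which vanishes at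
both ends, reduces the integral to Γ(1/2) = √π. With A = ω² this expresses the square root ω through
the semigroup e^{-sω²}. -/
theorem integral_rpow_mul_one_sub_exp {A : ℝ} (hA : 0 < A) :
    ∫ s in Set.Ioi (0 : ℝ), s ^ (-(3 / 2) : ℝ) * (1 - Real.exp (-s * A)) =
      2 * Real.sqrt Real.pi * Real.sqrt A := by
  have hi1 := integrable_rpow_mul_one_sub_exp hA.le
  have hi2 := (integrable_rpow_mul_exp hA).const_mul (2 * A)
  have key := integral_Ioi_of_hasDerivAt_of_tendsto
    (f := fun s : ℝ => -2 * (s ^ (-(1 / 2) : ℝ) * (1 - Real.exp (-s * A))))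
    (f' := fun s => s ^ (-(3 / 2) : ℝ) * (1 - Real.exp (-s * A)) -
      2 * A * (s ^ (-(1 / 2) : ℝ) * Real.exp (-s * A)))
    (a := 0) (m := 0) ?_ ?_ (hi1.sub hi2) ?_
  · rw [integral_sub hi1 hi2, integral_const_mul] at key
    have hG := Real.integral_rpow_mul_exp_neg_mul_Ioi (a := 1 / 2) (r := A) (by norm_num) hA
    have e : ∫ s in Set.Ioi (0 : ℝ), s ^ (-(1 / 2) : ℝ) * Real.exp (-s * A) =
        (1 / A) ^ (1 / 2 : ℝ) * Real.sqrt Real.pi := by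
      rw [← Real.Gamma_one_half_eq, ← hG]
      refine setIntegral_congr_fun measurableSet_Ioi fun s _ => ?_
      congr 2 <;> ring_nf
    rw [e, ← Real.sqrt_eq_rpow, Real.sqrt_div zero_le_one, Real.sqrt_one] at key
    simp only [neg_zero, zero_mul, Real.exp_zero, sub_self, mul_zero] at key
    have h3 : A * (1 / Real.sqrt A) = Real.sqrt A := by
      rw [mul_one_div, Real.div_sqrt]
    linear_combination key + 2 * Real.sqrt Real.pi * h3
  · have h0 : Tendsto (fun s : ℝ => 2 * A * s ^ (1 / 2 : ℝ)) (𝓝[Set.Ici 0] 0) (𝓝 0) := by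
      have : Continuous fun s : ℝ => 2 * A * s ^ (1 / 2 : ℝ) :=
        continuous_const.mul (Real.continuous_rpow_const (by norm_num))
      have h := (this.tendsto 0).mono_left (nhdsWithin_le_nhds (s := Set.Ici (0 : ℝ)))
      simpa using h
    rw [ContinuousWithinAt]
    simp only [neg_zero, zero_mul, Real.exp_zero, sub_self, mul_zero]
    refine squeeze_zero_norm' ?_ h0
    filter_upwards [self_mem_nhdsWithin] with s hs
    rcases (Set.mem_Ici.1 hs).eq_or_lt with rfl | hs0
    · simp
    have h1 : Real.exp (-s * A) ≤ 1 := Real.exp_le_one_iff.2 (by nlinarith)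
    have h2 := Real.add_one_le_exp (-s * A)
    rw [norm_mul, Real.norm_of_nonneg (mul_nonneg (by positivity) (by linarith))]
    have h3 : s ^ (-(1 / 2) : ℝ) * s = s ^ (1 / 2 : ℝ) := by
      nth_rewrite 2 [← Real.rpow_one s]
      rw [← Real.rpow_add hs0]; norm_num
    calc ‖(-2 : ℝ)‖ * (s ^ (-(1 / 2) : ℝ) * (1 - Real.exp (-s * A)))
        ≤ 2 * (s ^ (-(1 / 2) : ℝ) * (s * A)) := by
          rw [norm_neg, Real.norm_ofNat]; gcongr; linarith
      _ = 2 * A * (s ^ (-(1 / 2) : ℝ) * s) := by ring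
      _ = _ := by rw [h3]
  · intro s hs
    have hs0 : 0 < s := hs
    have h1 := Real.hasDerivAt_rpow_const (x := s) (p := -(1 / 2)) (Or.inl hs0.ne')
    have h2 : HasDerivAt (fun s : ℝ => 1 - Real.exp (-s * A)) (-(Real.exp (-s * A) * (-1 * A))) s :=
      (((hasDerivAt_id s).neg.mul_const A).exp).const_sub 1
    refine ((h1.mul h2).const_mul (-2)).congr_deriv ?_
    have : (-(1 / 2) - 1 : ℝ) = -(3 / 2) := by norm_num
    rw [this]
    ring
  · have h1 : Tendsto (fun s : ℝ => 2 * s ^ (-(1 / 2) : ℝ)) atTop (𝓝 0) := by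
      simpa using (tendsto_rpow_neg_atTop (y := 1 / 2) (by norm_num)).const_mul 2
    refine squeeze_zero_norm' ?_ h1
    filter_upwards [eventually_gt_atTop 0] with s hs0
    have h1 : Real.exp (-s * A) ≤ 1 := Real.exp_le_one_iff.2 (by nlinarith)
    have h2 := Real.exp_pos (-s * A)
    rw [norm_mul, Real.norm_of_nonneg (mul_nonneg (by positivity) (by linarith)), norm_neg,
      Real.norm_ofNat]
    gcongr
    exact mul_le_of_le_one_right (by positivity) (by linarith)

/-- The heat kernel has unit mass at every time, so Tonelli reduces the claim to integrability of φ.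
The factor `c` accommodates the doubled time of `norm_sq_mul_heatKernel_le`. -/
theorem integrable_mul_heatKernel {φ : ℝ → ℝ} (hφ : IntegrableOn φ (Set.Ioi 0)) {c : ℝ}
    (hc : 0 < c) : Integrable (fun z : ℝ × Space n => φ z.1 * heatKernel (c * z.1) z.2)
      ((volume.restrict (Set.Ioi 0)).prod volume) := by
  have hm : AEStronglyMeasurable (fun z : ℝ × Space n => φ z.1 * heatKernel (c * z.1) z.2)
      ((volume.restrict (Set.Ioi 0)).prod volume) := by
    refine hφ.1.comp_fst.mul ?_
    refine Measurable.aestronglyMeasurable ?_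
    unfold heatKernel
    fun_prop
  rw [integrable_prod_iff hm]
  constructor
  · filter_upwards [ae_restrict_mem measurableSet_Ioi] with s hs
    exact (integrable_heatKernel (mul_pos hc hs)).const_mul _
  · refine hφ.norm.congr ?_
    filter_upwards [ae_restrict_mem measurableSet_Ioi] with s hs
    have hcs : 0 < c * s := mul_pos hc hs
    simp only [norm_mul, Real.norm_of_nonneg (heatKernel_nonneg hcs _)]
    rw [integral_const_mul, integral_heatKernel hcs, mul_one]

end Kernel

/-! ### The Bessel kernel as a superposition of heat kernels. -/

section Bessel

/-- The factor e^{-b/s} beats any negative power at s = 0: it is at most k! (s/b)^k, and k > ν makes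
the remaining power integrable. -/
theorem integrableOn_rpow_mul_exp_neg_inv {a b : ℝ} (ha : 0 < a) (hb : 0 < b) (ν : ℝ) :
    IntegrableOn (fun s : ℝ => s ^ (-ν - 1) * Real.exp (-a * s - b / s)) (Set.Ioi 0) := by
  obtain ⟨k, hk⟩ := exists_nat_gt ν
  have h := integrableOn_rpow_mul_exp_neg_mul_rpow (p := 1) (s := k - ν - 1) (b := a)
    (by linarith) (by norm_num) ha
  refine (h.const_mul (k.factorial / b ^ k)).mono'
    (Measurable.aestronglyMeasurable (by fun_prop)) ?_
  filter_upwards [ae_restrict_mem measurableSet_Ioi] with s hs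
  have hs0 : 0 < s := hs
  have hle := Real.pow_div_factorial_le_exp (b / s) (by positivity) k
  have h1 : Real.exp (-(b / s)) ≤ k.factorial / b ^ k * s ^ (k : ℝ) := by
    rw [Real.exp_neg, Real.rpow_natCast, inv_le_comm₀ (Real.exp_pos _) (by positivity)]
    refine le_trans (le_of_eq ?_) hle
    rw [div_pow]
    field_simp
  have h2 : s ^ ((k : ℝ) - ν - 1) = s ^ (-ν - 1) * s ^ (k : ℝ) := by
    rw [← Real.rpow_add hs0]; ring_nf
  rw [Real.norm_of_nonneg (by positivity), Real.rpow_one, h2, sub_eq_add_neg (-a * s), Real.exp_add]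
  calc s ^ (-ν - 1) * (Real.exp (-a * s) * Real.exp (-(b / s)))
      ≤ s ^ (-ν - 1) * (Real.exp (-a * s) * (k.factorial / b ^ k * s ^ (k : ℝ))) := by gcongr
    _ = _ := by ring

/-- The Macdonald integral for the modified Bessel function of the second kind. -/
theorem integral_rpow_mul_exp_eq_besselK {a b : ℝ} (ha : 0 < a) (hb : 0 < b) (ν : ℝ) :
    ∫ s in Set.Ioi (0 : ℝ), s ^ (-ν - 1) * Real.exp (-a ^ 2 * s - b ^ 2 / s) =
      2 * (a / b) ^ ν * besselK ν (2 * a * b) := by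
  have hint := integrableOn_rpow_mul_exp_neg_inv (pow_pos ha 2) (pow_pos hb 2) ν
  -- The substitution s = (b/a) e^t symmetrizes the exponent: -a² s - b²/s = -2ab cosh t.
  have himg : (fun t : ℝ => b / a * Real.exp t) '' Set.univ = Set.Ioi 0 := by
    ext s
    simp only [Set.image_univ, Set.mem_range, Set.mem_Ioi]
    constructor
    · rintro ⟨t, rfl⟩; positivity
    · intro hs
      refine ⟨Real.log (a / b * s), ?_⟩
      rw [Real.exp_log (by positivity)]
      field_simp
  have hder : ∀ t ∈ Set.univ, HasDerivWithinAt (fun t : ℝ => b / a * Real.exp t)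
      (b / a * Real.exp t) Set.univ t := fun t _ =>
    ((Real.hasDerivAt_exp t).const_mul _).hasDerivWithinAt
  have hinj : Set.InjOn (fun t : ℝ => b / a * Real.exp t) Set.univ := by
    intro t _ t' _ h
    exact Real.exp_injective (mul_left_cancel₀ (by positivity) h)
  have hsub : ∀ t : ℝ, |b / a * Real.exp t| • ((b / a * Real.exp t) ^ (-ν - 1) *
      Real.exp (-a ^ 2 * (b / a * Real.exp t) - b ^ 2 / (b / a * Real.exp t))) =
      (a / b) ^ ν * (Real.exp (-(2 * a * b) * Real.cosh t) * Real.exp (-ν * t)) := by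
    intro t
    have hpos : 0 < b / a * Real.exp t := by positivity
    have h1 : (b / a * Real.exp t) * (b / a * Real.exp t) ^ (-ν - 1) =
        (a / b) ^ ν * Real.exp (-ν * t) := by
      nth_rewrite 1 [← Real.rpow_one (b / a * Real.exp t)]
      rw [← Real.rpow_add hpos, show 1 + (-ν - 1) = -ν by ring,
        Real.mul_rpow (by positivity) (by positivity), ← Real.exp_mul,
        Real.rpow_neg (by positivity),
        ← Real.inv_rpow (by positivity), inv_div]
      ring_nf
    have h2 : -a ^ 2 * (b / a * Real.exp t) - b ^ 2 / (b / a * Real.exp t) =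
        -(2 * a * b) * Real.cosh t := by
      rw [Real.cosh_eq, Real.exp_neg]
      field_simp
      ring
    rw [abs_of_pos hpos, smul_eq_mul, ← mul_assoc, h1, h2]
    ring
  rw [← himg, integral_image_eq_integral_abs_deriv_smul MeasurableSet.univ hder hinj]
  rw [← himg, integrableOn_image_iff_integrableOn_abs_deriv_smul MeasurableSet.univ hder hinj]
    at hint
  simp only [hsub, setIntegral_univ, integrableOn_univ] at hint ⊢
  rw [integral_const_mul]
  have hH := (hint.const_mul ((a / b) ^ ν)⁻¹)
  simp only [← mul_assoc, inv_mul_cancel₀ (Real.rpow_pos_of_pos (div_pos ha hb) ν).ne', one_mul]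
    at hH
  -- Adding the reflection t ↦ -t turns e^{-νt} into 2 cosh(νt), an even function, so the integral
  -- over the line is twice the one over the half-line.
  have hsymm : ∫ t : ℝ, Real.exp (-(2 * a * b) * Real.cosh t) * Real.exp (-ν * t) =
      2 * besselK ν (2 * a * b) := by
    have hn := integral_neg_eq_self
      (fun t : ℝ => Real.exp (-(2 * a * b) * Real.cosh t) * Real.exp (-ν * t)) volume
    have habs := integral_comp_abs
      (f := fun t : ℝ => Real.exp (-(2 * a * b) * Real.cosh t) * Real.cosh (ν * t))
    have hadd := integral_add hH hH.comp_neg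
    rw [hn] at hadd
    rw [besselK, ← habs]
    have e : (fun t : ℝ => Real.exp (-(2 * a * b) * Real.cosh t) * Real.exp (-ν * t) +
        Real.exp (-(2 * a * b) * Real.cosh (-t)) * Real.exp (-ν * -t)) =
        fun t => 2 * (Real.exp (-(2 * a * b) * Real.cosh |t|) * Real.cosh (ν * |t|)) := by
      funext t
      have : Real.cosh (ν * |t|) = Real.cosh (ν * t) := by
        rcases abs_choice t with h | h <;> rw [h]
        rw [mul_neg, Real.cosh_neg]
      rw [this, Real.cosh_abs, Real.cosh_neg, Real.cosh_eq (ν * t)]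
      ring_nf
    rw [e, integral_const_mul] at hadd
    linarith
  rw [hsymm]
  ring

/-- This is the Macdonald integral with a = m, b = |y|/2 and ν = (n+1)/2: the powers s^{-3/2} and
s^{-n/2} combine to s^{-ν-1}. The condition y ≠ 0 ensures b > 0. -/
theorem omegaTilde_eq_integral {n : ℕ} {m : ℝ} (hm : 0 < m) {y : Space n} (hy : y ≠ 0) :
    omegaTilde m y = -(2 * Real.sqrt Real.pi)⁻¹ * ∫ s in Set.Ioi (0 : ℝ),
      s ^ (-(3 / 2) : ℝ) * Real.exp (-s * m ^ 2) * heatKernel s y := by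
  have hr : 0 < ‖y‖ := norm_pos_iff.2 hy
  have h := integral_rpow_mul_exp_eq_besselK hm (half_pos hr) (((n : ℝ) + 1) / 2)
  have e : ∫ s in Set.Ioi (0 : ℝ), s ^ (-(3 / 2) : ℝ) * Real.exp (-s * m ^ 2) * heatKernel s y =
      (4 * Real.pi) ^ (-(n : ℝ) / 2) * ∫ s in Set.Ioi (0 : ℝ), s ^ (-(((n : ℝ) + 1) / 2) - 1) *
        Real.exp (-m ^ 2 * s - (‖y‖ / 2) ^ 2 / s) := by
    rw [← integral_const_mul]
    refine setIntegral_congr_fun measurableSet_Ioi fun s hs => ?_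
    have hs0 : 0 < s := hs
    simp only [heatKernel]
    rw [Real.mul_rpow (by positivity) hs0.le,
      show s ^ (-(((n : ℝ) + 1) / 2) - 1) = s ^ (-(3 / 2) : ℝ) * s ^ (-(n : ℝ) / 2) by
        rw [← Real.rpow_add hs0]; ring_nf,
      show Real.exp (-m ^ 2 * s - (‖y‖ / 2) ^ 2 / s) =
        Real.exp (-s * m ^ 2) * Real.exp (-(4 * s)⁻¹ * ‖y‖ ^ 2) by
        rw [← Real.exp_add]; congr 1; field_simp; ring]
    ring
  rw [e, h, omegaTilde]
  have h1 : (m / (‖y‖ / 2)) ^ (((n : ℝ) + 1) / 2) =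
      2 ^ (((n : ℝ) + 1) / 2) * (m / ‖y‖) ^ (((n : ℝ) + 1) / 2) := by
    rw [← Real.mul_rpow (by norm_num) (by positivity)]
    congr 1
    field_simp
  have h2 : (2 * Real.sqrt Real.pi)⁻¹ * (4 * Real.pi) ^ (-(n : ℝ) / 2) *
      2 ^ (((n : ℝ) + 1) / 2) = (2 * Real.pi) ^ (-((n : ℝ) + 1) / 2) := by
    have h3 : (2 * Real.sqrt Real.pi)⁻¹ = (4 * Real.pi) ^ (-(1 / 2) : ℝ) := by
      rw [Real.rpow_neg (by positivity), ← Real.sqrt_eq_rpow, Real.sqrt_mul (by norm_num),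
        show (4 : ℝ) = 2 ^ 2 by norm_num, Real.sqrt_sq (by norm_num)]
    rw [h3, ← Real.rpow_add (by positivity), show (4 : ℝ) * Real.pi = 2 * (2 * Real.pi) by ring,
      Real.mul_rpow (by norm_num) (by positivity), mul_right_comm, ← Real.rpow_add (by norm_num)]
    ring_nf
    simp
  rw [h1, ← h2]
  rw [show 2 * m * (‖y‖ / 2) = m * ‖y‖ by ring]
  ring

end Bessel

/-! ### Truncation of the kernel to |y| > ε and the limit of its symbol. -/

section Truncation

variable {n : ℕ}

/-- The exterior of the closed ball of radius `ε`. -/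
def exterior (n : ℕ) (ε : ℝ) : Set (Space n) := {y | ε < ‖y‖}

theorem measurableSet_exterior (ε : ℝ) : MeasurableSet (exterior n ε) :=
  measurableSet_lt measurable_const measurable_norm

/-- Lebesgue measure on the half space `s > 0` of proper time and position. -/
abbrev heatMeasure (n : ℕ) : Measure (ℝ × Space n) :=
  (volume.restrict (Set.Ioi 0)).prod volume

theorem ae_heatMeasure : ∀ᵐ z ∂heatMeasure n, 0 < z.1 :=
  Measure.quasiMeasurePreserving_fst.ae (ae_restrict_mem measurableSet_Ioi)

/-- The integrand `s^{-3/2} h_s(y)` of the massless kernel. -/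
def heatWeight (z : ℝ × Space n) : ℝ := z.1 ^ (-(3 / 2) : ℝ) * heatKernel z.1 z.2

theorem measurable_heatWeight : Measurable (heatWeight : ℝ × Space n → ℝ) :=
  (measurable_fst.pow_const _).mul measurable_heatKernel

theorem heatWeight_nonneg {z : ℝ × Space n} (hz : 0 < z.1) : 0 ≤ heatWeight z :=
  mul_nonneg (by positivity) (heatKernel_nonneg hz _)

/-- The common majorant for all dominated arguments below. The first summand is integrable by the
unit mass of the heat kernel, the second by trading |y|² for s. It is used with A = m² for the
symbol and with A = 1 for the massless weight. -/
theorem integrable_heatWeight_major {A : ℝ} (hA : 0 < A) :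
    Integrable (fun z : ℝ × Space n => heatWeight z *
      ((1 - Real.exp (-z.1 * A)) + Real.exp (-z.1 * A) * ‖z.2‖ ^ 2)) (heatMeasure n) := by
  have h1 := integrable_mul_heatKernel (n := n) (integrable_rpow_mul_one_sub_exp hA.le) one_pos
  have h2 := integrable_mul_heatKernel (n := n)
    ((integrable_rpow_mul_exp hA).const_mul (8 * 2 ^ ((n : ℝ) / 2))) two_pos
  refine (h1.add h2).mono' (Measurable.aestronglyMeasurable
    (measurable_heatWeight.mul (by fun_prop))) ?_
  filter_upwards [ae_heatMeasure] with z hz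
  have hexp : Real.exp (-z.1 * A) ≤ 1 := Real.exp_le_one_iff.2 (by nlinarith)
  have hle := norm_sq_mul_heatKernel_le hz z.2
  have hp : z.1 ^ (-(3 / 2) : ℝ) * z.1 = z.1 ^ (-(1 / 2) : ℝ) := by
    nth_rewrite 2 [← Real.rpow_one z.1]
    rw [← Real.rpow_add hz]; norm_num
  rw [Real.norm_of_nonneg (mul_nonneg (heatWeight_nonneg hz)
    (add_nonneg (by linarith) (by positivity)))]
  simp only [Pi.add_apply, heatWeight, one_mul]
  calc _ = z.1 ^ (-(3 / 2) : ℝ) * (1 - Real.exp (-z.1 * A)) * heatKernel z.1 z.2 +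
        z.1 ^ (-(3 / 2) : ℝ) * Real.exp (-z.1 * A) * (‖z.2‖ ^ 2 * heatKernel z.1 z.2) := by ring
    _ ≤ z.1 ^ (-(3 / 2) : ℝ) * (1 - Real.exp (-z.1 * A)) * heatKernel z.1 z.2 +
        z.1 ^ (-(3 / 2) : ℝ) * Real.exp (-z.1 * A) *
          (8 * 2 ^ ((n : ℝ) / 2) * z.1 * heatKernel (2 * z.1) z.2) := by gcongr
    _ = _ := by rw [← hp]; ring

/-- Where |y| > ε, the bracket (1 - e^{-s}) + e^{-s} |y|² is bounded below by 1/(1 + ε^{-2}), so the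
majorant with A = 1 dominates the bare weight. -/
theorem integrable_heatWeight_exterior {ε : ℝ} (hε : 0 < ε) :
    Integrable (heatWeight : ℝ × Space n → ℝ)
      ((volume.restrict (Set.Ioi 0)).prod (volume.restrict (exterior n ε))) := by
  have h := (integrable_heatWeight_major (n := n) one_pos).const_mul (1 + 1 / ε ^ 2)
  have e : (volume.restrict (Set.Ioi (0 : ℝ))).prod (volume.restrict (exterior n ε)) =
      (heatMeasure n).restrict (Set.univ ×ˢ exterior n ε) := by
    rw [← Measure.prod_restrict, Measure.restrict_univ]
  rw [e]
  refine (h.mono_measure Measure.restrict_le_self).mono'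
    measurable_heatWeight.aestronglyMeasurable ?_
  filter_upwards [ae_restrict_of_ae ae_heatMeasure,
    ae_restrict_mem (MeasurableSet.univ.prod (measurableSet_exterior ε))] with z hz hzε
  have hy : ε < ‖z.2‖ := hzε.2
  have hexp : Real.exp (-z.1 * 1) ≤ 1 := Real.exp_le_one_iff.2 (by nlinarith)
  have hexp0 := Real.exp_pos (-z.1 * 1)
  rw [Real.norm_of_nonneg (heatWeight_nonneg hz)]
  have h1 : 1 ≤ 1 / ε ^ 2 * ‖z.2‖ ^ 2 := by
    rw [one_div, ← div_eq_inv_mul, one_le_div (by positivity)]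
    gcongr
  have h2 : 1 ≤ (1 + 1 / ε ^ 2) *
      ((1 - Real.exp (-z.1 * 1)) + Real.exp (-z.1 * 1) * ‖z.2‖ ^ 2) := by
    have h3 : Real.exp (-z.1 * 1) * 1 ≤ Real.exp (-z.1 * 1) * (1 / ε ^ 2 * ‖z.2‖ ^ 2) := by
      gcongr
    have h4 : 0 ≤ 1 / ε ^ 2 * (1 - Real.exp (-z.1 * 1)) :=
      mul_nonneg (by positivity) (by linarith)
    have h5 : 0 ≤ Real.exp (-z.1 * 1) * ‖z.2‖ ^ 2 := by positivity
    nlinarith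
  calc heatWeight z = heatWeight z * 1 := (mul_one _).symm
    _ ≤ heatWeight z * ((1 + 1 / ε ^ 2) *
      ((1 - Real.exp (-z.1 * 1)) + Real.exp (-z.1 * 1) * ‖z.2‖ ^ 2)) :=
        mul_le_mul_of_nonneg_left h2 (heatWeight_nonneg hz)
    _ = _ := by ring

/-- The total weight of the massless kernel outside the ball of radius `ε` scales like `1/ε`. -/
theorem integral_heatWeight_exterior {ε : ℝ} (hε : 0 < ε) :
    ∫ z, heatWeight z ∂((volume.restrict (Set.Ioi 0)).prod (volume.restrict (exterior n ε))) =
      1 / ε * ∫ z, heatWeight z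
        ∂((volume.restrict (Set.Ioi 0)).prod (volume.restrict (exterior n 1))) := by
  rw [integral_prod _ (integrable_heatWeight_exterior hε),
    integral_prod _ (integrable_heatWeight_exterior one_pos)]
  -- Parabolic scaling: (s, y) ↦ (ε² s, ε y) preserves the measure h_s(y) dy and maps the exterior
  -- of radius 1 onto that of radius ε.
  have hin : ∀ s : ℝ, 0 < s → ∫ y in exterior n ε, heatKernel (ε ^ 2 * s) y =
      ∫ y in exterior n 1, heatKernel s y := by
    intro s hs
    rw [← integral_indicator (measurableSet_exterior _),
      ← integral_indicator (measurableSet_exterior _)]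
    have h := Measure.integral_comp_smul_of_nonneg (volume : Measure (Space n))
      ((exterior n ε).indicator (heatKernel (ε ^ 2 * s))) ε (hR := hε.le)
    rw [finrank_euclideanSpace, Fintype.card_fin, smul_eq_mul] at h
    have e : (fun y : Space n => (exterior n ε).indicator (heatKernel (ε ^ 2 * s)) (ε • y)) =
        fun y => (ε ^ n)⁻¹ * (exterior n 1).indicator (heatKernel s) y := by
      funext y
      have hmem : ε • y ∈ exterior n ε ↔ y ∈ exterior n 1 := by
        simp only [exterior, Set.mem_ofPred_eq, norm_smul, Real.norm_of_nonneg hε.le]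
        exact ⟨fun h => by nlinarith, fun h => by nlinarith⟩
      by_cases hy : y ∈ exterior n 1
      · rw [Set.indicator_of_mem (hmem.2 hy), Set.indicator_of_mem hy, heatKernel, heatKernel,
          norm_smul, Real.norm_of_nonneg hε.le,
          show 4 * Real.pi * (ε ^ 2 * s) = ε ^ 2 * (4 * Real.pi * s) by ring,
          Real.mul_rpow (by positivity) (by positivity), ← Real.rpow_natCast ε 2,
          ← Real.rpow_mul hε.le, ← Real.rpow_natCast ε n, ← Real.rpow_neg hε.le, mul_assoc]
        congr 2
        · push_cast; ring
        · congr 1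
          rw [Real.rpow_natCast]
          field_simp
      · rw [Set.indicator_of_notMem (fun h => hy (hmem.1 h)), Set.indicator_of_notMem hy, mul_zero]
    rw [e, integral_const_mul] at h
    exact (mul_left_cancel₀ (by positivity) h).symm
  have hout := integral_comp_mul_left_Ioi
    (fun s : ℝ => ∫ y in exterior n ε, heatWeight (s, y)) 0 (pow_pos hε 2)
  rw [mul_zero, smul_eq_mul] at hout
  -- The factor ε^{-3} is (ε²)^{-3/2}; together with ε² from ds it leaves 1/ε.
  have e2 : ∫ s in Set.Ioi (0 : ℝ), ∫ y in exterior n ε, heatWeight (ε ^ 2 * s, y) =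
      (ε ^ 3)⁻¹ * ∫ s in Set.Ioi (0 : ℝ), ∫ y in exterior n 1, heatWeight (s, y) := by
    rw [← integral_const_mul]
    refine setIntegral_congr_fun measurableSet_Ioi fun s hs => ?_
    have hs0 : 0 < s := hs
    simp only [heatWeight, integral_const_mul]
    rw [hin s hs, Real.mul_rpow (by positivity) hs0.le, ← Real.rpow_natCast ε 2,
      ← Real.rpow_mul hε.le, ← Real.rpow_natCast ε 3, ← Real.rpow_neg hε.le]
    norm_num
    ring
  rw [e2] at hout
  have h3 : ∫ s in Set.Ioi (0 : ℝ), ∫ y in exterior n ε, heatWeight (s, y) =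
      ε ^ 2 * ((ε ^ 2)⁻¹ * ∫ s in Set.Ioi (0 : ℝ), ∫ y in exterior n ε, heatWeight (s, y)) := by
    field_simp
  rw [h3, ← hout]
  field_simp

variable {m : ℝ}

/-- The compensated integrand of the massive kernel paired with a plane wave. -/
def compensated (m : ℝ) (p : Space n) (z : ℝ × Space n) : ℝ :=
  heatWeight z * (1 - Real.exp (-z.1 * m ^ 2) * Real.cos (inner ℝ p z.2))

theorem measurable_compensated (p : Space n) : Measurable (compensated m p) :=
  measurable_heatWeight.mul (by fun_prop)

/-- With E = e^{-sm²}, write 1 - E cos θ = (1 - E) + E (1 - cos θ) and use 1 - cos θ ≤ θ²/2 with |θ|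
≤ |p||y|. The momentum then enters only through the factor 1 + |p|². -/
theorem norm_compensated_le (p : Space n) {z : ℝ × Space n} (hz : 0 < z.1) :
    ‖compensated m p z‖ ≤ (1 + ‖p‖ ^ 2) * (heatWeight z *
      ((1 - Real.exp (-z.1 * m ^ 2)) + Real.exp (-z.1 * m ^ 2) * ‖z.2‖ ^ 2)) := by
  have hexp : Real.exp (-z.1 * m ^ 2) ≤ 1 := Real.exp_le_one_iff.2 (by nlinarith [sq_nonneg m])
  have hexp0 := Real.exp_pos (-z.1 * m ^ 2)
  have hw := heatWeight_nonneg hz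
  have hcos := Real.one_sub_sq_div_two_le_cos (x := inner ℝ p z.2)
  have hcos1 := Real.cos_le_one (inner ℝ p z.2)
  have hin : (inner ℝ p z.2 : ℝ) ^ 2 ≤ ‖p‖ ^ 2 * ‖z.2‖ ^ 2 := by
    rw [← mul_pow, ← sq_abs]
    gcongr
    exact abs_real_inner_le_norm _ _
  have h0 : 0 ≤ 1 - Real.exp (-z.1 * m ^ 2) * Real.cos (inner ℝ p z.2) := by nlinarith
  rw [compensated, Real.norm_of_nonneg (mul_nonneg hw h0), mul_left_comm]
  refine mul_le_mul_of_nonneg_left ?_ hw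
  have h1 : Real.exp (-z.1 * m ^ 2) * (1 - Real.cos (inner ℝ p z.2)) ≤
      Real.exp (-z.1 * m ^ 2) * (‖p‖ ^ 2 * ‖z.2‖ ^ 2) := by
    gcongr
    nlinarith [sq_nonneg (inner ℝ p z.2 : ℝ)]
  have h2 : 0 ≤ ‖p‖ ^ 2 * (1 - Real.exp (-z.1 * m ^ 2)) :=
    mul_nonneg (by positivity) (by linarith)
  have h3 : 0 ≤ Real.exp (-z.1 * m ^ 2) * ‖z.2‖ ^ 2 := by positivity
  nlinarith

theorem integrable_compensated (hm : 0 < m) (p : Space n) :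
    Integrable (compensated m p) (heatMeasure n) := by
  refine ((integrable_heatWeight_major (pow_pos hm 2)).const_mul (1 + ‖p‖ ^ 2)).mono'
    (measurable_compensated p).aestronglyMeasurable ?_
  filter_upwards [ae_heatMeasure] with z hz using norm_compensated_le p hz

/-- The y-integral yields s^{-3/2} (1 - e^{-s(|p|² + m²)}), and the s-integral is the square root
formula with A = |p|² + m². -/
theorem integral_compensated (hm : 0 < m) (p : Space n) :
    ∫ z, compensated m p z ∂heatMeasure n = 2 * Real.sqrt Real.pi * energy m p := by
  rw [integral_prod _ (integrable_compensated hm p), energy,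
    ← integral_rpow_mul_one_sub_exp (show 0 < ‖p‖ ^ 2 + m ^ 2 by positivity)]
  refine setIntegral_congr_fun measurableSet_Ioi fun s hs => ?_
  have hs0 : 0 < s := hs
  have hi : Integrable (fun y : Space n => heatKernel s y * Real.cos (inner ℝ p y)) :=
    (integrable_heatKernel hs0).mul_bdd (c := 1) (by fun_prop)
      (Eventually.of_forall fun y => Real.abs_cos_le_one _)
  calc ∫ y, compensated m p (s, y) = ∫ y : Space n, s ^ (-(3 / 2) : ℝ) * (heatKernel s y -
        Real.exp (-s * m ^ 2) * (heatKernel s y * Real.cos (inner ℝ p y))) := by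
        refine integral_congr_ae (Eventually.of_forall fun y => ?_)
        simp only [compensated, heatWeight]
        ring
    _ = _ := by
      rw [integral_const_mul, integral_sub (integrable_heatKernel hs0) (hi.const_mul _),
        integral_const_mul, integral_heatKernel hs0, integral_heatKernel_mul_cos hs0,
        ← Real.exp_add]
      ring_nf

theorem ae_ne_zero (hn : 1 ≤ n) : ∀ᵐ y : Space n, y ≠ 0 := by
  have : Nontrivial (Space n) := by
    have : Nonempty (Fin n) := ⟨⟨0, hn⟩⟩
    infer_instance
  rw [ae_iff]
  simp

theorem omegaTilde_eq_integral_heatWeight (hm : 0 < m) {ε : ℝ} (hε : 0 < ε) {y : Space n}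
    (hy : y ∈ exterior n ε) :
    omegaTilde m y = -(2 * Real.sqrt Real.pi)⁻¹ * ∫ s in Set.Ioi (0 : ℝ),
      heatWeight (s, y) * Real.exp (-s * m ^ 2) := by
  rw [omegaTilde_eq_integral hm (norm_pos_iff.1 (hε.trans hy))]
  congr 1
  refine integral_congr_ae (Eventually.of_forall fun s => ?_)
  simp only [heatWeight]
  ring

theorem integrable_heatWeight_mul {ε : ℝ} (hε : 0 < ε) (f : ℝ × Space n → ℝ) (hf : Measurable f)
    (hb : ∀ z, 0 < z.1 → |f z| ≤ 1) :
    Integrable (fun z => heatWeight z * f z)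
      ((volume.restrict (Set.Ioi 0)).prod (volume.restrict (exterior n ε))) := by
  refine (integrable_heatWeight_exterior hε).mul_bdd (c := 1) hf.aestronglyMeasurable ?_
  have : ∀ᵐ z ∂(volume.restrict (Set.Ioi (0 : ℝ))).prod (volume.restrict (exterior n ε)), 0 < z.1 :=
    Measure.quasiMeasurePreserving_fst.ae (ae_restrict_mem measurableSet_Ioi)
  filter_upwards [this] with z hz using hb z hz

theorem integrableOn_omegaTilde (hm : 0 < m) {ε : ℝ} (hε : 0 < ε) :
    IntegrableOn (omegaTilde m) (exterior n ε) := by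
  have h := (integrable_heatWeight_mul (n := n) hε (fun z => Real.exp (-z.1 * m ^ 2))
    (by fun_prop) (fun z hz => by
      rw [abs_of_pos (Real.exp_pos _)]
      exact Real.exp_le_one_iff.2 (by nlinarith [sq_nonneg m]))).integral_prod_right
  refine (h.const_mul (-(2 * Real.sqrt Real.pi)⁻¹)).congr ?_
  filter_upwards [ae_restrict_mem (measurableSet_exterior ε)] with y hy
  rw [omegaTilde_eq_integral_heatWeight hm hε hy]

/-- The cosine transform of the kernel truncated at radius `ε`. -/
def truncatedSymbol (m ε : ℝ) (p : Space n) : ℝ :=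
  ∫ y in exterior n ε, omegaTilde m y * Real.cos (inner ℝ p y)

/-- The coefficient of the divergent part `1/ε` of the truncated symbol. -/
def divergentCoeff (n : ℕ) : ℝ := -(2 * Real.sqrt Real.pi)⁻¹ *
  ∫ z, heatWeight z ∂((volume.restrict (Set.Ioi 0)).prod (volume.restrict (exterior n 1)))

/-- Away from the origin the two terms of `compensated` are separately integrable. The first
contributes exactly the 1/ε term, with a coefficient independent of m and p, and Fubini identifies
the second with the truncated symbol. The right-hand side is no longer singular as ε → 0. -/
theorem truncatedSymbol_sub (hm : 0 < m) {ε : ℝ} (hε : 0 < ε) (p : Space n) :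
    truncatedSymbol m ε p - 1 / ε * divergentCoeff n = (2 * Real.sqrt Real.pi)⁻¹ *
      ∫ z in Set.univ ×ˢ exterior n ε, compensated m p z ∂heatMeasure n := by
  have hi := integrable_heatWeight_mul (n := n) hε
    (fun z => Real.exp (-z.1 * m ^ 2) * Real.cos (inner ℝ p z.2)) (by fun_prop) (fun z hz => by
      rw [abs_mul, abs_of_pos (Real.exp_pos _)]
      exact mul_le_one₀ (Real.exp_le_one_iff.2 (by nlinarith [sq_nonneg m])) (abs_nonneg _)
        (Real.abs_cos_le_one _))
  have h1 : truncatedSymbol m ε p = -(2 * Real.sqrt Real.pi)⁻¹ *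
      ∫ z, heatWeight z * (Real.exp (-z.1 * m ^ 2) * Real.cos (inner ℝ p z.2))
        ∂((volume.restrict (Set.Ioi 0)).prod (volume.restrict (exterior n ε))) := by
    rw [integral_prod_symm _ hi, ← integral_const_mul, truncatedSymbol]
    refine setIntegral_congr_fun (measurableSet_exterior ε) fun y hy => ?_
    simp only
    rw [omegaTilde_eq_integral_heatWeight hm hε hy, mul_assoc, ← integral_mul_const]
    congr 1
    refine integral_congr_ae (Eventually.of_forall fun s => ?_)
    simp only
    ring
  have e : (heatMeasure n).restrict (Set.univ ×ˢ exterior n ε) =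
      (volume.restrict (Set.Ioi (0 : ℝ))).prod (volume.restrict (exterior n ε)) := by
    rw [← Measure.prod_restrict, Measure.restrict_univ]
  have h2 : ∫ z in Set.univ ×ˢ exterior n ε, compensated m p z ∂heatMeasure n =
      (∫ z, heatWeight z ∂((volume.restrict (Set.Ioi 0)).prod (volume.restrict (exterior n ε)))) -
      ∫ z, heatWeight z * (Real.exp (-z.1 * m ^ 2) * Real.cos (inner ℝ p z.2))
        ∂((volume.restrict (Set.Ioi 0)).prod (volume.restrict (exterior n ε))) := by
    rw [e, ← integral_sub (integrable_heatWeight_exterior hε) hi]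
    refine integral_congr_ae (Eventually.of_forall fun z => ?_)
    simp only [compensated]
    ring
  rw [h2, h1, integral_heatWeight_exterior hε, divergentCoeff]
  ring

/-- The majorant is integrated over the whole half space, so the constant does not depend on ε. This
uniformity is what dominated convergence in p requires. -/
theorem exists_truncatedSymbol_bound (n : ℕ) (hm : 0 < m) : ∃ C : ℝ, ∀ ε > 0, ∀ p : Space n,
    |truncatedSymbol m ε p - 1 / ε * divergentCoeff n| ≤ C * (1 + ‖p‖ ^ 2) := by
  refine ⟨(2 * Real.sqrt Real.pi)⁻¹ * ∫ z : ℝ × Space n, heatWeight z *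
      ((1 - Real.exp (-z.1 * m ^ 2)) + Real.exp (-z.1 * m ^ 2) * ‖z.2‖ ^ 2) ∂heatMeasure n,
    fun ε hε p => ?_⟩
  rw [truncatedSymbol_sub hm hε, abs_mul, abs_of_pos (by positivity), mul_assoc]
  gcongr
  rw [← Real.norm_eq_abs, mul_comm, ← integral_const_mul]
  refine (norm_integral_le_integral_norm _).trans ?_
  have hi := (integrable_compensated hm p).norm
  refine (setIntegral_le_integral hi (Eventually.of_forall fun z => norm_nonneg _)).trans ?_
  refine integral_mono_ae hi ((integrable_heatWeight_major (pow_pos hm 2)).const_mul _) ?_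
  filter_upwards [ae_heatMeasure] with z hz using norm_compensated_le p hz

/-- The exteriors exhaust everything except y = 0, which is a null set because n ≥ 1. -/
theorem tendsto_truncatedSymbol (hn : 1 ≤ n) (hm : 0 < m) (p : Space n) :
    Tendsto (fun ε => truncatedSymbol m ε p - 1 / ε * divergentCoeff n) (𝓝[>] 0)
      (𝓝 (energy m p)) := by
  have h : Tendsto (fun ε => ∫ z, (Set.univ ×ˢ exterior n ε).indicator (compensated m p) z
      ∂heatMeasure n) (𝓝[>] 0) (𝓝 (∫ z, compensated m p z ∂heatMeasure n)) := by
    refine tendsto_integral_filter_of_dominated_convergence (fun z => ‖compensated m p z‖) ?_ ?_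
      (integrable_compensated hm p).norm ?_
    · exact Eventually.of_forall fun ε => ((measurable_compensated p).indicator
        (MeasurableSet.univ.prod (measurableSet_exterior ε))).aestronglyMeasurable
    · exact Eventually.of_forall fun ε => Eventually.of_forall fun z =>
        norm_indicator_le_norm_self _ _
    · have : ∀ᵐ z ∂heatMeasure n, z.2 ≠ 0 :=
        Measure.quasiMeasurePreserving_snd.ae (ae_ne_zero hn)
      filter_upwards [this] with z hz
      refine tendsto_const_nhds.congr' ?_
      have hpos : 0 < ‖z.2‖ := norm_pos_iff.2 hz
      filter_upwards [Ioo_mem_nhdsGT hpos] with ε hε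
      rw [Set.indicator_of_mem]
      exact ⟨trivial, hε.2⟩
  rw [integral_compensated hm p] at h
  have h2 := h.const_mul (2 * Real.sqrt Real.pi)⁻¹
  rw [← mul_assoc, inv_mul_cancel₀ (by positivity), one_mul] at h2
  refine h2.congr' ?_
  filter_upwards [self_mem_nhdsWithin] with ε hε
  rw [truncatedSymbol_sub hm hε,
    integral_indicator (MeasurableSet.univ.prod (measurableSet_exterior ε))]

end Truncation

/-! ### Convolution with ω̃ as multiplication by the energy. -/

section Convolution

variable {n : ℕ} {m : ℝ} {F : Type*} [NormedAddCommGroup F] [InnerProductSpace ℂ F]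

theorem integral_even_mul_cexp {κ : Space n → ℝ} (hκ : Integrable κ) (heven : ∀ y, κ (-y) = κ y)
    (p : Space n) :
    ∫ y, (κ y : ℂ) * Complex.exp (-(Complex.I * (inner ℝ p y : ℝ))) =
      ((∫ y, κ y * Real.cos (inner ℝ p y) : ℝ) : ℂ) := by
  have hi : Integrable (fun y => (κ y : ℂ) * Complex.exp (-(Complex.I * (inner ℝ p y : ℝ)))) := by
    refine hκ.ofReal.mul_bdd (c := 1) (by fun_prop) (Eventually.of_forall fun y => ?_)
    simp [Complex.norm_exp]
  have hn := integral_neg_eq_self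
    (fun y => (κ y : ℂ) * Complex.exp (-(Complex.I * (inner ℝ p y : ℝ)))) volume
  have hadd := integral_add hi hi.comp_neg
  rw [hn] at hadd
  have e : ∀ y, (κ y : ℂ) * Complex.exp (-(Complex.I * (inner ℝ p y : ℝ))) +
      (κ (-y) : ℂ) * Complex.exp (-(Complex.I * (inner ℝ p (-y) : ℝ))) =
      2 * ((κ y * Real.cos (inner ℝ p y) : ℝ) : ℂ) := by
    intro y
    rw [heven, inner_neg_right]
    push_cast
    rw [Complex.cos]
    ring_nf
  simp_rw [e] at hadd
  rw [integral_const_mul, ← two_mul] at hadd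
  rw [← integral_complex_ofReal]
  exact (mul_left_cancel₀ two_ne_zero hadd).symm

theorem continuous_truncatedSymbol (hm : 0 < m) {ε : ℝ} (hε : 0 < ε) :
    Continuous (truncatedSymbol m ε : Space n → ℝ) := by
  have hi := integrableOn_omegaTilde (n := n) hm hε
  refine continuous_of_dominated (bound := fun y => ‖omegaTilde m y‖) (fun p => ?_) (fun p => ?_)
    hi.norm ?_
  · exact hi.1.mul (Continuous.aestronglyMeasurable (by fun_prop))
  · refine Eventually.of_forall fun y => ?_
    rw [norm_mul]
    exact mul_le_of_le_one_right (norm_nonneg _) (Real.abs_cos_le_one _)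
  · exact Eventually.of_forall fun y => by fun_prop

/-- The truncated kernel is integrable and the wave transform is bounded, so Fubini applies and
convolution becomes multiplication by the symbol. The kernel is even, hence only the cosine
survives. -/
theorem setIntegral_omegaTilde_smul_waveTransform [CompleteSpace F] (hm : 0 < m) {ε : ℝ}
    (hε : 0 < ε) {g : Space n → F} (hg : Integrable g) (x : Space n) :
    IntegrableOn (fun y => omegaTilde m (x - y) • waveTransform g y) {y | ε < ‖x - y‖} ∧
    ∫ y in {y | ε < ‖x - y‖}, omegaTilde m (x - y) • waveTransform g y =
      waveTransform (fun p => (truncatedSymbol m ε p : ℂ) • g p) x := by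
  set κ : Space n → ℝ := (exterior n ε).indicator (omegaTilde m) with hκdef
  have hκ : Integrable κ :=
    (integrableOn_omegaTilde hm hε).integrable_indicator (measurableSet_exterior ε)
  have heven : ∀ y, κ (-y) = κ y := fun y => by
    simp [hκdef, Set.indicator, exterior, omegaTilde]
  have hms : MeasurableSet {y : Space n | ε < ‖x - y‖} :=
    measurableSet_lt measurable_const (by fun_prop)
  have hind : {y : Space n | ε < ‖x - y‖}.indicator
      (fun y => omegaTilde m (x - y) • waveTransform g y) =
      fun y => (fun u => κ u • waveTransform g (x - u)) (x - y) := by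
    funext y
    by_cases hy : ε < ‖x - y‖
    · simp [hκdef, Set.indicator, exterior, hy]
    · simp [hκdef, Set.indicator, exterior, hy]
  have hint : Integrable (fun u => κ u • waveTransform g (x - u)) := by
    refine hκ.smul_bdd ((2 * Real.pi) ^ (-(n : ℝ) / 2) * ∫ p, ‖g p‖)
      ((continuous_waveTransform hg).comp (continuous_const.sub continuous_id)).aestronglyMeasurable
      (Eventually.of_forall fun u => norm_waveTransform_le g _)
  rw [← integrable_indicator_iff hms, ← integral_indicator hms, hind]
  refine ⟨hint.comp_sub_left x, ?_⟩
  rw [integral_sub_left_eq_self (fun u => κ u • waveTransform g (x - u)) volume x]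
  have hprod : Integrable (Function.uncurry fun (u p : Space n) =>
      (κ u : ℂ) • (Complex.exp (Complex.I * (inner ℝ p (x - u) : ℝ)) • g p))
      (volume.prod volume) := by
    have h := (Integrable.smul_prod (hκ.ofReal (𝕜 := ℂ)) hg).bdd_smul
      (φ := fun z : Space n × Space n =>
        Complex.exp (Complex.I * (inner ℝ z.2 (x - z.1) : ℝ))) 1
      (Continuous.aestronglyMeasurable (by fun_prop))
      (Eventually.of_forall fun z => by simp [Complex.norm_exp])
    refine h.congr (Eventually.of_forall fun z => ?_)
    exact smul_comm _ _ _
  calc ∫ u, κ u • waveTransform g (x - u)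
      = (((2 * Real.pi) ^ (-(n : ℝ) / 2) : ℝ) : ℂ) • ∫ u, ∫ p,
        (κ u : ℂ) • (Complex.exp (Complex.I * (inner ℝ p (x - u) : ℝ)) • g p) := by
        rw [← integral_smul]
        refine integral_congr_ae (Eventually.of_forall fun u => ?_)
        simp only [waveTransform]
        rw [integral_smul, ← Complex.coe_smul, smul_comm]
    _ = _ := by
        rw [integral_integral_swap hprod, waveTransform]
        congr 1
        refine integral_congr_ae (Eventually.of_forall fun p => ?_)
        have e : ∀ u, (κ u : ℂ) • (Complex.exp (Complex.I * (inner ℝ p (x - u) : ℝ)) • g p) =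
            ((κ u : ℂ) * Complex.exp (-(Complex.I * (inner ℝ p u : ℝ)))) •
              (Complex.exp (Complex.I * (inner ℝ p x : ℝ)) • g p) := by
          intro u
          rw [smul_smul, smul_smul, mul_assoc, ← Complex.exp_add, inner_sub_right]
          push_cast
          ring_nf
        simp only [e]
        rw [integral_smul_const, integral_even_mul_cexp hκ heven, smul_comm]
        congr 3
        rw [truncatedSymbol, ← integral_indicator (measurableSet_exterior ε)]
        refine integral_congr_ae (Eventually.of_forall fun u => ?_)
        simp [hκdef, Set.indicator]

theorem hasConvolution_waveTransform [CompleteSpace F] (hn : 1 ≤ n) (hm : 0 < m)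
    {g : Space n → F} (hg : Integrable g) (hg2 : Integrable (fun p => ‖p‖ ^ 2 * ‖g p‖))
    (x : Space n) :
    HasConvolution (omegaTilde m) (waveTransform g) x
      (waveTransform (fun p => (energy m p : ℂ) • g p) x) := by
  -- A single divergent term suffices: with N = 1 the only index is 0, which stands for 1/ε, and the
  -- logarithmic coefficient is 0.
  refine ⟨fun ε hε => (setIntegral_omegaTilde_smul_waveTransform hm hε hg x).1, 1,
    fun _ => divergentCoeff n • waveTransform g x, 0, ?_⟩
  obtain ⟨C, hC⟩ := exists_truncatedSymbol_bound n hm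
  have hlim : Tendsto (fun ε => waveTransform
      (fun p => ((truncatedSymbol m ε p - 1 / ε * divergentCoeff n : ℝ) : ℂ) • g p) x) (𝓝[>] 0)
      (𝓝 (waveTransform (fun p => (energy m p : ℂ) • g p) x)) := by
    refine Tendsto.const_smul ?_ _
    -- The bound C(1 + |p|²) on the subtracted symbol is why a second moment of g is assumed.
    refine tendsto_integral_filter_of_dominated_convergence
      (fun p => C * (‖g p‖ + ‖p‖ ^ 2 * ‖g p‖)) ?_ ?_ ((hg.norm.add hg2).const_mul C) ?_
    · filter_upwards [self_mem_nhdsWithin] with ε hε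
      have := continuous_truncatedSymbol (n := n) hm hε
      exact (Continuous.aestronglyMeasurable (by fun_prop)).smul
        ((Continuous.aestronglyMeasurable (by fun_prop)).smul hg.1)
    · filter_upwards [self_mem_nhdsWithin] with ε hε
      refine Eventually.of_forall fun p => ?_
      have h := hC ε hε p
      simp only [norm_smul, Complex.norm_exp, Complex.norm_real, Real.norm_eq_abs]
      simp only [Complex.mul_re, Complex.I_re, zero_mul, Complex.I_im, Complex.ofReal_im, mul_zero,
        sub_self, Real.exp_zero, one_mul]
      calc _ ≤ C * (1 + ‖p‖ ^ 2) * ‖g p‖ := by gcongr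
        _ = _ := by ring
    · refine Eventually.of_forall fun p => ?_
      refine Tendsto.const_smul ?_ _
      refine Tendsto.smul_const ?_ _
      exact (Complex.continuous_ofReal.tendsto _).comp (tendsto_truncatedSymbol hn hm p)
  refine hlim.congr' ?_
  filter_upwards [self_mem_nhdsWithin] with ε hε
  rw [(setIntegral_omegaTilde_smul_waveTransform hm hε hg x).2]
  simp only [Finset.univ_unique, Fin.default_eq_zero, Fin.isValue, Fin.val_zero, zero_add, pow_one,
    Finset.sum_singleton, smul_zero, add_zero]
  have hT := continuous_truncatedSymbol (n := n) hm hε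
  have hTg : Integrable (fun p => (truncatedSymbol m ε p : ℂ) • g p) :=
    hg.bdd_smul (φ := fun p => (truncatedSymbol m ε p : ℂ)) (∫ y in exterior n ε, ‖omegaTilde m y‖)
      (Continuous.aestronglyMeasurable (by fun_prop)) (Eventually.of_forall fun p => by
        rw [Complex.norm_real, truncatedSymbol]
        refine norm_integral_le_of_norm_le (integrableOn_omegaTilde hm hε).norm
          (Eventually.of_forall fun y => ?_)
        rw [norm_mul]
        exact mul_le_of_le_one_right (norm_nonneg _) (Real.abs_cos_le_one _))
  have hcg : Integrable (fun p => ((1 / ε * divergentCoeff n : ℝ) : ℂ) • g p) := hg.smul _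
  rw [smul_smul, ← Complex.coe_smul, ← waveTransform_const_smul, ← waveTransform_sub hTg hcg]
  congr 1
  funext p
  rw [← sub_smul]
  push_cast
  rfl

end Convolution

/-! ### Rapidly decaying vector-valued functions. -/

section RapidDecay

variable {n : ℕ} {F : Type*} [NormedAddCommGroup F]

/-- Continuous functions on momentum space that decay faster than any power. -/
structure RapidDecay (h : Space n → F) : Prop where
  continuous : Continuous h
  decay : ∀ N : ℕ, ∃ C : ℝ, ∀ p, (1 + ‖p‖) ^ N * ‖h p‖ ≤ C

namespace RapidDecay

theorem zero : RapidDecay (fun _ : Space n => (0 : F)) :=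
  ⟨continuous_const, fun N => ⟨0, fun p => by simp⟩⟩

theorem add {f g : Space n → F} (hf : RapidDecay f) (hg : RapidDecay g) :
    RapidDecay (fun p => f p + g p) := by
  refine ⟨hf.continuous.add hg.continuous, fun N => ?_⟩
  obtain ⟨C, hC⟩ := hf.decay N
  obtain ⟨D, hD⟩ := hg.decay N
  refine ⟨C + D, fun p => ?_⟩
  calc (1 + ‖p‖) ^ N * ‖f p + g p‖ ≤ (1 + ‖p‖) ^ N * (‖f p‖ + ‖g p‖) := by
        gcongr; exact norm_add_le _ _
    _ ≤ C + D := by rw [mul_add]; exact add_le_add (hC p) (hD p)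

theorem smul [NormedSpace ℂ F] {h : Space n → F} (hh : RapidDecay h) {φ : Space n → ℂ}
    (hφ : Continuous φ) {C : ℝ} {k : ℕ} (hb : ∀ p, ‖φ p‖ ≤ C * (1 + ‖p‖) ^ k) :
    RapidDecay (fun p => φ p • h p) := by
  refine ⟨hφ.smul hh.continuous, fun N => ?_⟩
  obtain ⟨D, hD⟩ := hh.decay (N + k)
  have hC : 0 ≤ C := by simpa using (norm_nonneg _).trans (hb 0)
  refine ⟨C * D, fun p => ?_⟩
  rw [norm_smul]
  calc (1 + ‖p‖) ^ N * (‖φ p‖ * ‖h p‖) ≤ (1 + ‖p‖) ^ N * (C * (1 + ‖p‖) ^ k * ‖h p‖) := by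
        gcongr; exact hb p
    _ = C * ((1 + ‖p‖) ^ (N + k) * ‖h p‖) := by ring
    _ ≤ C * D := by gcongr; exact hD p

theorem integrable_pow_mul {h : Space n → F} (hh : RapidDecay h) (k : ℕ) :
    Integrable (fun p => ‖p‖ ^ k * ‖h p‖) := by
  obtain ⟨N, hN⟩ := (inferInstance : (volume : Measure (Space n)).HasTemperateGrowth)
  obtain ⟨C, hC⟩ := hh.decay (k + N)
  have hcont := hh.continuous
  refine (hN.const_mul C).mono' (Continuous.aestronglyMeasurable (by fun_prop))
    (Eventually.of_forall fun p => ?_)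
  rw [Real.norm_of_nonneg (by positivity), Real.rpow_neg (by positivity), Real.rpow_natCast,
    ← div_eq_mul_inv, le_div_iff₀ (by positivity)]
  calc ‖p‖ ^ k * ‖h p‖ * (1 + ‖p‖) ^ N ≤ (1 + ‖p‖) ^ k * ‖h p‖ * (1 + ‖p‖) ^ N := by
        gcongr; linarith
    _ = (1 + ‖p‖) ^ (k + N) * ‖h p‖ := by ring
    _ ≤ C := hC p

theorem integrable {h : Space n → F} (hh : RapidDecay h) : Integrable h := by
  refine (integrable_norm_iff hh.continuous.aestronglyMeasurable).1 ?_
  simpa using hh.integrable_pow_mul 0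

theorem memLp_two {h : Space n → F} (hh : RapidDecay h) : MemLp h 2 := by
  rw [memLp_two_iff_integrable_sq_norm hh.continuous.aestronglyMeasurable]
  obtain ⟨C, hC⟩ := hh.decay 0
  have hcont := hh.continuous
  refine (hh.integrable.norm.const_mul C).mono' (Continuous.aestronglyMeasurable (by fun_prop))
    (Eventually.of_forall fun p => ?_)
  have := hC p
  rw [pow_zero, one_mul] at this
  rw [Real.norm_of_nonneg (by positivity), sq]
  gcongr

end RapidDecay

end RapidDecay

/-! ### Rapid decay of the annihilation amplitude in the sharp momentum. -/

section Slices

/-- The `L²` norm of a Schwartz function is controlled by a weighted supremum norm. -/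
theorem exists_norm_toLp_le {E : Type*} [NormedAddCommGroup E] [NormedSpace ℝ E]
    [MeasurableSpace E] [BorelSpace E] [SecondCountableTopology E] (μ : Measure E)
    [hμ : μ.HasTemperateGrowth] :
    ∃ (M : ℕ) (B : ℝ), ∀ (h : 𝓢(E, ℂ)) (D : ℝ),
      (∀ q, (1 + ‖q‖) ^ M * ‖h q‖ ≤ D) → ‖h.toLp 2 μ‖ ≤ D * B := by
  obtain ⟨M, hM⟩ := hμ.exists_eLpNorm_lt_top 2
  refine ⟨M, (eLpNorm (fun x : E => (1 + ‖x‖) ^ (-(M : ℝ))) 2 μ).toReal, fun h D hD => ?_⟩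
  have hD0 : 0 ≤ D := le_trans (by positivity) (hD 0)
  rw [SchwartzMap.norm_toLp, ← ENNReal.toReal_ofReal hD0, ← ENNReal.toReal_mul]
  refine ENNReal.toReal_mono (ENNReal.mul_ne_top ENNReal.ofReal_ne_top hM.ne) ?_
  refine eLpNorm_le_mul_eLpNorm_of_ae_le_mul (Eventually.of_forall fun q => ?_) 2
  rw [Real.norm_of_nonneg (by positivity), Real.rpow_neg (by positivity), Real.rpow_natCast,
    ← div_eq_mul_inv, le_div_iff₀ (by positivity), mul_comm]
  exact hD q

variable {n : ℕ} {m : ℝ} [Fact (0 < m)]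

theorem toKParticle_coe (k : ℕ) (f : symSchwartz n k) :
    (toKParticle n m k f : Lp ℂ 2 (kMeasure n m k)) = f.1.toLp 2 (kMeasure n m k) := rfl

theorem toFock_single (k : ℕ) (f : symSchwartz n k) :
    toFock m (DFinsupp.single k f : Dom n) =
      (lp.single 2 k (toKParticle n m k f) : lp (fun k : ℕ => kParticleSpace n m k) 2) := by
  refine Subtype.ext (funext fun l => ?_)
  change toKParticle n m l ((DFinsupp.single k f : Dom n) l) =
    (Pi.single k (toKParticle n m k f) : ∀ l, kParticleSpace n m l) l
  by_cases h : k = l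
  · subst h; simp
  · rw [DFinsupp.single_eq_of_ne (Ne.symm h), Pi.single_eq_of_ne (Ne.symm h), map_zero]

theorem norm_toFock_single (k : ℕ) (f : symSchwartz n k) :
    ‖toFock m (DFinsupp.single k f : Dom n)‖ = ‖f.1.toLp 2 (kMeasure n m k)‖ := by
  rw [toFock_single]
  exact lp.norm_single (E := fun k : ℕ => kParticleSpace n m k) (p := 2) (by norm_num) k
    (toKParticle n m k f)

theorem annihilationCov_single_succ (k : ℕ) (f : symSchwartz n (k + 1)) (p : Space n) :
    annihilationCov p (DFinsupp.single (k + 1) f : Dom n) =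
      DFinsupp.single k (((Real.sqrt (k + 1) : ℝ) : ℂ) • slice k p f) := by
  refine DFinsupp.ext fun l => ?_
  change ((Real.sqrt (l + 1) : ℝ) : ℂ) • slice l p ((DFinsupp.single (k + 1) f : Dom n) (l + 1)) = _
  by_cases h : k = l
  · subst h; simp
  · rw [DFinsupp.single_eq_of_ne (fun e => h (by omega)), DFinsupp.single_eq_of_ne (Ne.symm h),
      map_zero, smul_zero]

theorem annihilationCov_single_zero (f : symSchwartz n 0) (p : Space n) :
    annihilationCov p (DFinsupp.single 0 f : Dom n) = 0 := by
  refine DFinsupp.ext fun l => ?_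
  change ((Real.sqrt (l + 1) : ℝ) : ℂ) • slice l p ((DFinsupp.single 0 f : Dom n) (l + 1)) = 0
  rw [DFinsupp.single_eq_of_ne (by omega), map_zero, smul_zero]

theorem slice_apply (k : ℕ) (p : Space n) (f : symSchwartz n (k + 1)) (q : Fin k → Space n) :
    (slice k p f).1 q = f.1 (Fin.cons p q) := rfl

theorem norm_le_norm_cons_left {k : ℕ} (p : Space n) (q : Fin k → Space n) :
    ‖p‖ ≤ ‖(Fin.cons p q : Fin (k + 1) → Space n)‖ := by
  simpa using norm_le_pi_norm (Fin.cons p q : Fin (k + 1) → Space n) 0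

theorem norm_le_norm_cons_right {k : ℕ} (p : Space n) (q : Fin k → Space n) :
    ‖q‖ ≤ ‖(Fin.cons p q : Fin (k + 1) → Space n)‖ :=
  (pi_norm_le_iff_of_nonneg (norm_nonneg _)).2 fun i => by
    simpa using norm_le_pi_norm (Fin.cons p q : Fin (k + 1) → Space n) i.succ

/-- In the supremum norm both ‖p‖ and ‖q‖ are at most ‖(p, q)‖, so one Schwartz seminorm of order N
+ M controls the product of the two weights. -/
theorem slice_decay {k : ℕ} (f : symSchwartz n (k + 1)) (M N : ℕ) : ∃ D : ℝ, ∀ p q,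
    (1 + ‖p‖) ^ N * ((1 + ‖q‖) ^ M * ‖(slice k p f).1 q‖) ≤ D := by
  refine ⟨_, fun p q => le_trans ?_ (SchwartzMap.one_add_le_sup_seminorm_apply (𝕜 := ℝ)
    (m := (N + M, 0)) le_rfl le_rfl f.1 (Fin.cons p q))⟩
  rw [norm_iteratedFDeriv_zero, slice_apply, pow_add, mul_assoc]
  gcongr
  · exact norm_le_norm_cons_left p q
  · exact norm_le_norm_cons_right p q

theorem slice_lipschitz {k : ℕ} (f : symSchwartz n (k + 1)) (M : ℕ) : ∃ D : ℝ, ∀ p p' q,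
    (1 + ‖q‖) ^ M * ‖(slice k p f - slice k p' f).1 q‖ ≤ D * ‖p - p'‖ := by
  obtain ⟨D, hD⟩ : ∃ D : ℝ, ∀ z, (1 + ‖z‖) ^ M * ‖fderiv ℝ f.1 z‖ ≤ D := by
    refine ⟨_, fun z => le_trans (le_of_eq ?_) (SchwartzMap.one_add_le_sup_seminorm_apply (𝕜 := ℝ)
      (m := (M, 1)) le_rfl le_rfl f.1 z)⟩
    rw [norm_iteratedFDeriv_one]
  refine ⟨D, fun p p' q => ?_⟩
  have hD0 : 0 ≤ D := le_trans (by positivity) (hD 0)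
  -- Mean value inequality on the convex set of points with tail q. There ‖q‖ ≤ ‖z‖, so the Schwartz
  -- decay of the derivative is uniform in the first momentum.
  have key := Convex.norm_image_sub_le_of_norm_fderiv_le (𝕜 := ℝ) (f := f.1)
    (s := {z | Fin.tail z = q}) (C := D / (1 + ‖q‖) ^ M) (x := Fin.cons p' q) (y := Fin.cons p q)
    (fun z _ => f.1.differentiableAt) (fun z hz => ?_) (fun z hz z' hz' a b _ _ hab => ?_)
    (Fin.tail_cons _ _) (Fin.tail_cons _ _)
  · have hn : ‖(Fin.cons p q : Fin (k + 1) → Space n) - Fin.cons p' q‖ ≤ ‖p - p'‖ := by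
      refine (pi_norm_le_iff_of_nonneg (norm_nonneg _)).2 fun i => ?_
      refine Fin.cases ?_ (fun j => ?_) i <;> simp
    have e : ‖(slice k p f - slice k p' f).1 q‖ =
        ‖f.1 (Fin.cons p q) - f.1 (Fin.cons p' q)‖ := rfl
    rw [e, mul_comm, ← le_div_iff₀ (by positivity)]
    refine key.trans ?_
    rw [mul_div_right_comm]
    gcongr
  · have hq : ‖q‖ ≤ ‖z‖ := by
      rw [← Fin.cons_self_tail z, show Fin.tail z = q from hz]
      exact norm_le_norm_cons_right _ _
    rw [le_div_iff₀ (by positivity), mul_comm]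
    refine le_trans ?_ (hD z)
    gcongr
  · funext i
    have h1 := congrFun hz i
    have h2 := congrFun hz' i
    simp only [Fin.tail] at h1 h2
    simp only [Fin.tail, Pi.add_apply, Pi.smul_apply, h1, h2, ← add_smul, hab, one_smul]

/-- By additivity a single component suffices. The Fock norm of a slice is an L² norm, hence
controlled by a weighted supremum: the Lipschitz estimate yields continuity in p, the joint decay
estimate yields decay. -/
theorem rapidDecay_toFock_annihilationCov (Ψ : Dom n) :
    RapidDecay (fun p => toFock m (annihilationCov p Ψ)) := by
  induction Ψ using DFinsupp.induction with
  | h0 => simpa using RapidDecay.zero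
  | ha k f Ψ _ _ ih =>
    simp only [map_add]
    refine RapidDecay.add ?_ ih
    cases k with
    | zero => simpa [annihilationCov_single_zero] using RapidDecay.zero
    | succ k =>
      obtain ⟨M, B, hB⟩ := exists_norm_toLp_le (kMeasure n m k)
      simp only [annihilationCov_single_succ, DFinsupp.single_smul, map_smul]
      refine RapidDecay.smul (φ := fun _ => ((Real.sqrt (k + 1) : ℝ) : ℂ)) (k := 0)
        (C := Real.sqrt (k + 1)) ⟨?_, fun N => ?_⟩ continuous_const ?_
      · obtain ⟨D, hD⟩ := slice_lipschitz f M
        refine (LipschitzWith.of_dist_le' (K := D * B) fun p p' => ?_).continuous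
        rw [dist_eq_norm, dist_eq_norm, ← map_sub, ← DFinsupp.single_sub, norm_toFock_single]
        refine (hB _ _ (hD p p')).trans_eq ?_
        ring
      · obtain ⟨D, hD⟩ := slice_decay f M N
        refine ⟨D * B, fun p => ?_⟩
        rw [norm_toFock_single, mul_comm, ← le_div_iff₀ (by positivity), mul_div_right_comm]
        refine hB _ _ fun q => ?_
        rw [le_div_iff₀ (by positivity), mul_comm]
        exact hD p q
      · intro p
        simp [abs_of_nonneg (Real.sqrt_nonneg _)]

theorem energy_pos (p : Space n) : 0 < energy m p :=
  (Fact.out : 0 < m).trans_le (le_energy p)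

/-- Annihilation of a particle with sharp momentum depends on the momentum like a continuous
rapidly decaying function. -/
theorem rapidDecay_annihilation (Ψ : Dom n) : RapidDecay (fun p => annihilation m p Ψ) := by
  have hm : 0 < m := Fact.out
  have hpos : ∀ p : Space n, 0 < energy m p := fun p => energy_pos p
  refine (rapidDecay_toFock_annihilationCov (m := m) Ψ).smul
    (φ := fun p => ((1 / Real.sqrt (2 * energy m p) : ℝ) : ℂ)) (k := 0)
    (C := 1 / Real.sqrt (2 * m)) ?_ fun p => ?_
  · have := continuous_energy (n := n) m
    refine Complex.continuous_ofReal.comp (continuous_const.div (by fun_prop) fun p => ?_)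
    exact (Real.sqrt_pos.2 (mul_pos two_pos (hpos p))).ne'
  · rw [Complex.norm_real, Real.norm_of_nonneg (by positivity), pow_zero, mul_one]
    gcongr
    exact le_energy p

end Slices

/-! ### Construction of the momentum operators and their matrix elements. -/

section Momentum

variable {n : ℕ} {m : ℝ}

/-- The form ω = m (1 + |p/m|²)^{1/2} exhibits smoothness, which at p = 0 depends on m > 0. -/
theorem hasTemperateGrowth_energy (hm : 0 < m) :
    (energy m : Space n → ℝ).HasTemperateGrowth := by
  have e : (energy m : Space n → ℝ) =
      fun p => m * (1 + ‖(m⁻¹ • ContinuousLinearMap.id ℝ (Space n)) p‖ ^ 2) ^ (1 / 2 : ℝ) := by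
    funext p
    have h1 : ‖p‖ ^ 2 + m ^ 2 =
        m ^ 2 * (1 + ‖(m⁻¹ • ContinuousLinearMap.id ℝ (Space n)) p‖ ^ 2) := by
      simp only [smul_apply, ContinuousLinearMap.id_apply, norm_smul, norm_inv,
        Real.norm_of_nonneg hm.le]
      field_simp
      ring
    rw [energy, h1, Real.sqrt_mul (by positivity), Real.sqrt_sq hm.le, Real.sqrt_eq_rpow]
  rw [e]
  exact (Function.HasTemperateGrowth.const m).mul
    ((Function.hasTemperateGrowth_one_add_norm_sq_rpow (Space n) (1 / 2)).comp
      (ContinuousLinearMap.hasTemperateGrowth _))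

theorem hasTemperateGrowth_covMomentum (hm : 0 < m) (μ : Fin (n + 1)) :
    (fun p : Space n => covMomentum m p μ).HasTemperateGrowth := by
  refine Fin.cases ?_ (fun j => ?_) μ
  · exact hasTemperateGrowth_energy hm
  · simp only [covMomentum, Fin.cons_succ]
    exact (-(EuclideanSpace.proj j : Space n →L[ℝ] ℝ)).hasTemperateGrowth

theorem continuous_covMomentum (m : ℝ) (μ : Fin (n + 1)) :
    Continuous (fun p : Space n => covMomentum m p μ) := by
  refine Fin.cases ?_ (fun j => ?_) μ
  · exact continuous_energy m
  · simp only [covMomentum, Fin.cons_succ]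
    fun_prop

theorem abs_covMomentum_le (hm : 0 < m) (μ : Fin (n + 1)) (p : Space n) :
    |covMomentum m p μ| ≤ (1 + m) * (1 + ‖p‖) ^ 1 := by
  have h1 : ‖p‖ + m ≤ (1 + m) * (1 + ‖p‖) ^ 1 := by
    rw [pow_one]; nlinarith [norm_nonneg p, mul_nonneg hm.le (norm_nonneg p)]
  refine le_trans ?_ h1
  refine Fin.cases ?_ (fun j => ?_) μ
  · simp only [covMomentum, Fin.cons_zero, energy]
    rw [abs_of_nonneg (Real.sqrt_nonneg _)]
    exact Real.sqrt_le_iff.2 ⟨by positivity, by nlinarith [mul_nonneg hm.le (norm_nonneg p)]⟩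
  · simp only [covMomentum, Fin.cons_succ, abs_neg]
    have h2 : |p j| ≤ ‖p‖ := by simpa using PiLp.norm_apply_le p j
    linarith

/-- The momentum component of the particle with label `i`. -/
def particleMomentum (m : ℝ) {k : ℕ} (μ : Fin (n + 1)) (i : Fin k) (q : Fin k → Space n) : ℂ :=
  (covMomentum m (q i) μ : ℂ)

/-- The total momentum of `k` particles. -/
def totalMomentum (m : ℝ) {k : ℕ} (μ : Fin (n + 1)) (q : Fin k → Space n) : ℂ :=
  ∑ i, particleMomentum m μ i q

theorem hasTemperateGrowth_particleMomentum (hm : 0 < m) {k : ℕ} (μ : Fin (n + 1)) (i : Fin k) :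
    (particleMomentum m μ i).HasTemperateGrowth :=
  Complex.ofRealCLM.hasTemperateGrowth.comp ((hasTemperateGrowth_covMomentum hm μ).comp
    (ContinuousLinearMap.proj (R := ℝ) (φ := fun _ : Fin k => Space n) i).hasTemperateGrowth)

theorem hasTemperateGrowth_totalMomentum (hm : 0 < m) (k : ℕ) (μ : Fin (n + 1)) :
    (totalMomentum m μ : (Fin k → Space n) → ℂ).HasTemperateGrowth :=
  Function.HasTemperateGrowth.sum fun i _ => hasTemperateGrowth_particleMomentum hm μ i

theorem totalMomentum_perm {k : ℕ} (μ : Fin (n + 1)) (σ : Equiv.Perm (Fin k))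
    (q : Fin k → Space n) : totalMomentum m μ (q ∘ σ) = totalMomentum m μ q :=
  Equiv.sum_comp σ fun i => particleMomentum m μ i q

theorem integrable_inner_of_memLp {α F : Type*} [MeasurableSpace α] {μ : Measure α}
    [NormedAddCommGroup F] [InnerProductSpace ℂ F] {f g : α → F} (hf : MemLp f 2 μ)
    (hg : MemLp g 2 μ) : Integrable (fun x => inner ℂ (f x) (g x)) μ := by
  refine (L2.integrable_inner (𝕜 := ℂ) (hf.toLp f) (hg.toLp g)).congr ?_
  filter_upwards [hf.coeFn_toLp, hg.coeFn_toLp] with x h1 h2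
  rw [h1, h2]

theorem integral_kMeasure_succ {k : ℕ} {H : (Fin (k + 1) → Space n) → ℂ}
    (hH : Integrable H (kMeasure n m (k + 1))) :
    ∫ z, H z ∂kMeasure n m (k + 1) =
      ∫ p, ∫ q, H (Fin.cons p q) ∂kMeasure n m k ∂massShellMeasure n m := by
  have hmp := (measurePreserving_piFinSuccAbove (fun _ : Fin (k + 1) => massShellMeasure n m)
    0).symm
  have hemb := ((MeasurableEquiv.piFinSuccAbove (fun _ : Fin (k + 1) => Space n) 0).symm
    ).measurableEmbedding
  have e : ∀ z : Space n × (Fin k → Space n),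
      (MeasurableEquiv.piFinSuccAbove (fun _ : Fin (k + 1) => Space n) 0).symm z =
      Fin.cons z.1 z.2 := fun z => by
    simp only [MeasurableEquiv.piFinSuccAbove, Fin.insertNthEquiv_zero]
    rfl
  have hi := (hmp.integrable_comp_emb hemb).2 hH
  simp only [Function.comp_def, e] at hi
  rw [← hmp.integral_comp hemb]
  simp only [e]
  exact integral_prod _ hi

variable [hm : Fact (0 < m)]

variable (m) in
/-- Multiplication by the total momentum on `k`-particle Schwartz functions. -/
def mulTotalMomentum (μ : Fin (n + 1)) (k : ℕ) : symSchwartz n k →ₗ[ℂ] symSchwartz n k :=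
  ((SchwartzMap.smulLeftCLM ℂ (totalMomentum m μ)).toLinearMap ∘ₗ
    (symSchwartz n k).subtype).codRestrict (symSchwartz n k) (by
      intro f σ q
      have ht := hasTemperateGrowth_totalMomentum hm.out k μ
      simp only [LinearMap.comp_apply, Submodule.subtype_apply, ContinuousLinearMap.coe_coe]
      rw [SchwartzMap.smulLeftCLM_apply_apply ht, SchwartzMap.smulLeftCLM_apply_apply ht,
        totalMomentum_perm, f.2 σ q])

theorem mulTotalMomentum_apply (μ : Fin (n + 1)) (k : ℕ) (f : symSchwartz n k)
    (q : Fin k → Space n) : (mulTotalMomentum m μ k f).1 q = totalMomentum m μ q * f.1 q :=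
  SchwartzMap.smulLeftCLM_apply_apply (hasTemperateGrowth_totalMomentum hm.out k μ) f.1 q

variable (m) in
/-- The second-quantized momentum operator. -/
def momentumOperator (μ : Fin (n + 1)) : Dom n →ₗ[ℂ] Fock n m :=
  toFock m ∘ₗ DFinsupp.mapRange.linearMap (mulTotalMomentum m μ)

theorem momentumOperator_single (μ : Fin (n + 1)) (k : ℕ) (f : symSchwartz n k) :
    momentumOperator m μ (DFinsupp.single k f) =
      toFock m (DFinsupp.single k (mulTotalMomentum m μ k f)) := by
  simp [momentumOperator]

theorem inner_toFock_single_left (k : ℕ) (f : symSchwartz n k)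
    (v : lp (fun k : ℕ => kParticleSpace n m k) 2) :
    inner ℂ (toFock m (DFinsupp.single k f)) (show Fock n m from v) =
      inner ℂ (toKParticle n m k f) (v k) := by
  rw [toFock_single]
  exact lp.inner_single_left (𝕜 := ℂ) (G := fun k : ℕ => kParticleSpace n m k) k
    (toKParticle n m k f) v

theorem inner_toFock_single_same (k : ℕ) (f g : symSchwartz n k) :
    inner ℂ (toFock m (DFinsupp.single k f)) (toFock m (DFinsupp.single k g)) =
      ∫ q, inner ℂ (f.1 q) (g.1 q) ∂kMeasure n m k := by
  rw [toFock_single k g]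
  refine (inner_toFock_single_left k f _).trans ?_
  rw [lp.single_apply_self, Submodule.coe_inner, toKParticle_coe, toKParticle_coe]
  exact SchwartzMap.inner_toL2_toL2_eq f.1 g.1 (kMeasure n m k)

theorem inner_toFock_single_of_ne {k l : ℕ} (h : k ≠ l) (f : symSchwartz n k)
    (g : symSchwartz n l) :
    inner ℂ (toFock m (DFinsupp.single k f)) (toFock m (DFinsupp.single l g)) = 0 := by
  rw [toFock_single l g]
  refine (inner_toFock_single_left k f _).trans ?_
  rw [lp.single_apply_ne _ _ _ h, inner_zero_right]

theorem integral_massShellMeasure {F : Type*} [NormedAddCommGroup F] [NormedSpace ℝ F]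
    (h : Space n → F) :
    ∫ p, h p ∂massShellMeasure n m = ∫ p, (1 / (2 * energy m p)) • h p := by
  have hc := continuous_energy (n := n) m
  rw [massShellMeasure, integral_withDensity_eq_integral_toReal_smul (by fun_prop)
    (Eventually.of_forall fun p => ENNReal.ofReal_lt_top)]
  refine integral_congr_ae (Eventually.of_forall fun p => ?_)
  simp only
  rw [ENNReal.toReal_ofReal]
  have := energy_pos (m := m) p
  positivity

theorem annihilation_apply (p : Space n) (Ψ : Dom n) : annihilation m p Ψ =
    ((1 / Real.sqrt (2 * energy m p) : ℝ) : ℂ) • toFock m (annihilationCov p Ψ) := rfl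

theorem inner_annihilation_single_succ (k : ℕ) (f g : symSchwartz n (k + 1)) (p : Space n) :
    inner ℂ (annihilation m p (DFinsupp.single (k + 1) f))
      (annihilation m p (DFinsupp.single (k + 1) g)) =
    ((1 / (2 * energy m p) * (k + 1) : ℝ) : ℂ) *
      ∫ q, inner ℂ (f.1 (Fin.cons p q)) (g.1 (Fin.cons p q)) ∂kMeasure n m k := by
  have hpos := energy_pos (m := m) p
  rw [annihilation_apply, annihilation_apply, annihilationCov_single_succ,
    annihilationCov_single_succ, DFinsupp.single_smul, DFinsupp.single_smul, map_smul, map_smul,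
    inner_smul_left, inner_smul_right, inner_smul_left, inner_smul_right, inner_toFock_single_same,
    Complex.conj_ofReal, Complex.conj_ofReal]
  simp only [slice_apply]
  have h1 : (1 / Real.sqrt (2 * energy m p)) * (1 / Real.sqrt (2 * energy m p)) =
      1 / (2 * energy m p) := by
    rw [div_mul_div_comm, one_mul, Real.mul_self_sqrt (by positivity)]
  have h2 : Real.sqrt ((k : ℝ) + 1) * Real.sqrt (k + 1) = k + 1 :=
    Real.mul_self_sqrt (by positivity)
  rw [show 1 / (2 * energy m p) * (k + 1) = (1 / Real.sqrt (2 * energy m p)) *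
    (1 / Real.sqrt (2 * energy m p)) * (Real.sqrt ((k : ℝ) + 1) * Real.sqrt (k + 1)) by rw [h1, h2]]
  push_cast
  ring

/-- Exchanging particles 0 and i preserves the measure and both symmetric functions. -/
theorem integral_particleMomentum_mul_inner {k : ℕ} (μ : Fin (n + 1)) (f g : symSchwartz n (k + 1))
    (i : Fin (k + 1)) :
    ∫ q, particleMomentum m μ i q * inner ℂ (f.1 q) (g.1 q) ∂kMeasure n m (k + 1) =
      ∫ q, particleMomentum m μ 0 q * inner ℂ (f.1 q) (g.1 q) ∂kMeasure n m (k + 1) := by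
  have hmp := measurePreserving_perm n m (k + 1) (Equiv.swap 0 i)
  have hcont : Continuous fun q : Fin (k + 1) → Space n =>
      particleMomentum m μ 0 q * inner ℂ (f.1 q) (g.1 q) := by
    have h1 := f.1.continuous
    have h2 := g.1.continuous
    have h3 : Continuous (particleMomentum m μ (0 : Fin (k + 1))) :=
      (hasTemperateGrowth_particleMomentum hm.out μ 0).1.continuous
    fun_prop
  have h := integral_map hmp.measurable.aemeasurable
    (hcont.aestronglyMeasurable (μ := Measure.map _ (kMeasure n m (k + 1))))
  rw [hmp.map_eq] at h
  rw [h]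
  refine integral_congr_ae (Eventually.of_forall fun q => ?_)
  simp only
  rw [f.2, g.2]
  simp [particleMomentum]

/-- The total momentum gives k + 1 equal terms, which supply the two factors √(k+1). Splitting off
the first momentum leaves the density 1/(2ω), which supplies the two factors 1/√(2ω). -/
theorem inner_momentumOperator_single_succ (μ : Fin (n + 1)) (k : ℕ)
    (f g : symSchwartz n (k + 1)) :
    inner ℂ (toFock m (DFinsupp.single (k + 1) f))
        (momentumOperator m μ (DFinsupp.single (k + 1) g)) =
      ∫ p, inner ℂ (annihilation m p (DFinsupp.single (k + 1) f))
        ((covMomentum m p μ : ℂ) • annihilation m p (DFinsupp.single (k + 1) g)) := by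
  have hint : ∀ i : Fin (k + 1), Integrable (fun q => particleMomentum m μ i q *
      inner ℂ (f.1 q) (g.1 q)) (kMeasure n m (k + 1)) := by
    intro i
    have ht := hasTemperateGrowth_particleMomentum hm.out μ i
    refine (integrable_inner_of_memLp (f.1.memLp 2 (kMeasure n m (k + 1)))
      ((SchwartzMap.smulLeftCLM ℂ (particleMomentum m μ i) g.1).memLp 2 (kMeasure n m (k + 1)))).congr
      (Eventually.of_forall fun q => ?_)
    simp only [SchwartzMap.smulLeftCLM_apply_apply ht, inner_smul_right]
  have h1 : ∀ q, inner ℂ (f.1 q) ((mulTotalMomentum m μ (k + 1) g).1 q) =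
      ∑ i, particleMomentum m μ i q * inner ℂ (f.1 q) (g.1 q) := by
    intro q
    rw [mulTotalMomentum_apply, ← smul_eq_mul, inner_smul_right, totalMomentum, Finset.sum_mul]
  rw [momentumOperator_single, inner_toFock_single_same]
  simp only [h1]
  rw [integral_finsetSum _ fun i _ => hint i]
  simp only [integral_particleMomentum_mul_inner]
  rw [Finset.sum_const, Finset.card_univ, Fintype.card_fin, integral_kMeasure_succ (hint 0),
    integral_massShellMeasure, nsmul_eq_mul, ← integral_const_mul]
  refine integral_congr_ae (Eventually.of_forall fun p => ?_)
  simp only [inner_smul_right, inner_annihilation_single_succ, particleMomentum, Fin.cons_zero,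
    integral_const_mul]
  rw [Complex.real_smul]
  push_cast
  ring

theorem rapidDecay_covMomentum_smul_annihilation (μ : Fin (n + 1)) (Ψ : Dom n) :
    RapidDecay (fun p => (covMomentum m p μ : ℂ) • annihilation m p Ψ) :=
  (rapidDecay_annihilation Ψ).smul
    (Complex.continuous_ofReal.comp (continuous_covMomentum m μ))
    fun p => (Complex.norm_real _).trans_le (abs_covMomentum_le hm.out μ p)

theorem integrable_inner_annihilation (μ : Fin (n + 1)) (Φ Ψ : Dom n) :
    Integrable (fun p => inner ℂ (annihilation m p Φ)
      ((covMomentum m p μ : ℂ) • annihilation m p Ψ)) :=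
  integrable_inner_of_memLp (rapidDecay_annihilation Φ).memLp_two
    (rapidDecay_covMomentum_smul_annihilation μ Ψ).memLp_two

theorem annihilation_single_zero (f : symSchwartz n 0) (p : Space n) :
    annihilation m p (DFinsupp.single 0 f) = 0 := by
  rw [annihilation_apply, annihilationCov_single_zero, map_zero, smul_zero]

theorem inner_momentumOperator_single (μ : Fin (n + 1)) (k l : ℕ) (f : symSchwartz n k)
    (g : symSchwartz n l) :
    inner ℂ (toFock m (DFinsupp.single k f)) (momentumOperator m μ (DFinsupp.single l g)) =
      ∫ p, inner ℂ (annihilation m p (DFinsupp.single k f))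
        ((covMomentum m p μ : ℂ) • annihilation m p (DFinsupp.single l g)) := by
  by_cases hkl : k = l
  · subst hkl
    cases k with
    | zero =>
      have h0 : mulTotalMomentum m μ 0 g = 0 := by
        refine Subtype.ext (SchwartzMap.ext fun q => ?_)
        rw [mulTotalMomentum_apply, totalMomentum, Finset.univ_eq_empty, Finset.sum_empty, zero_mul]
        rfl
      simp [momentumOperator_single, h0, annihilation_single_zero]
    | succ k => exact inner_momentumOperator_single_succ μ k f g
  · rw [momentumOperator_single, inner_toFock_single_of_ne hkl]
    symm
    rw [← integral_zero (Space n) ℂ]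
    refine integral_congr_ae (Eventually.of_forall fun p => ?_)
    simp only
    cases k with
    | zero => rw [annihilation_single_zero, inner_zero_left]
    | succ k =>
      cases l with
      | zero => rw [annihilation_single_zero, smul_zero, inner_zero_right]
      | succ l =>
        rw [annihilation_apply, annihilation_apply, annihilationCov_single_succ,
          annihilationCov_single_succ, inner_smul_left, inner_smul_right, inner_smul_right,
          inner_toFock_single_of_ne (fun e => hkl (by rw [e]))]
        simp

/-- Matrix elements of the momentum operator. -/
theorem inner_momentumOperator (μ : Fin (n + 1)) (Φ Ψ : Dom n) :
    inner ℂ (toFock m Φ) (momentumOperator m μ Ψ) =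
      ∫ p, inner ℂ (annihilation m p Φ) ((covMomentum m p μ : ℂ) • annihilation m p Ψ) := by
  induction Φ using DFinsupp.induction with
  | h0 => simp
  | ha k f Φ _ _ ihΦ =>
    simp only [map_add, inner_add_left]
    rw [integral_add (integrable_inner_annihilation μ _ _) (integrable_inner_annihilation μ _ _),
      ihΦ]
    congr 1
    clear ihΦ
    induction Ψ using DFinsupp.induction with
    | h0 => simp
    | ha l g Ψ _ _ ihΨ =>
      simp only [map_add, smul_add, inner_add_right]
      rw [integral_add (integrable_inner_annihilation μ _ _)
        (integrable_inner_annihilation μ _ _), ihΨ, inner_momentumOperator_single]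

theorem isMomentumOperator_momentumOperator (μ : Fin (n + 1)) :
    IsMomentumOperator μ (momentumOperator (n := n) m μ) :=
  fun Φ Ψ => ⟨integrable_inner_annihilation μ Φ Ψ, inner_momentumOperator μ Φ Ψ⟩

end Momentum

/-! ### The domain separates the vectors of the Fock space. -/

section Density

variable {n : ℕ}

/-- Relabelling the arguments of a Schwartz function of `k` momenta. -/
def permSchwartz {k : ℕ} (σ : Equiv.Perm (Fin k)) :
    𝓢(Fin k → Space n, ℂ) →L[ℂ] 𝓢(Fin k → Space n, ℂ) :=
  SchwartzMap.compCLM ℂ (g := fun q : Fin k → Space n => q ∘ σ)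
    (ContinuousLinearMap.pi fun i : Fin k => ContinuousLinearMap.proj (R := ℝ)
      (φ := fun _ : Fin k => Space n) (σ i)).hasTemperateGrowth
    ⟨1, 1, fun q => by
      rw [pow_one, one_mul]
      refine (pi_norm_le_iff_of_nonneg (by positivity)).2 fun i => ?_
      have := norm_le_pi_norm (q ∘ σ) (σ.symm i)
      rw [Function.comp_apply, Equiv.apply_symm_apply] at this
      linarith⟩

theorem permSchwartz_apply {k : ℕ} (σ : Equiv.Perm (Fin k)) (f : 𝓢(Fin k → Space n, ℂ))
    (q : Fin k → Space n) : permSchwartz σ f q = f (q ∘ σ) := rfl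

/-- The symmetrization of a Schwartz function of `k` momenta. -/
def symmetrize {k : ℕ} (f : 𝓢(Fin k → Space n, ℂ)) : symSchwartz n k :=
  -- The sum is not divided by k!; this factor reappears in `inner_toLp_symmetrize`, where only its
  -- being nonzero matters.
  ⟨∑ σ : Equiv.Perm (Fin k), permSchwartz σ f, fun τ q => by
    simp only [sum_apply, permSchwartz_apply]
    refine Fintype.sum_equiv (Equiv.mulLeft τ) _ _ fun σ => ?_
    rfl⟩

variable {m : ℝ} [hm : Fact (0 < m)]

instance instIsLocallyFiniteMassShell : IsLocallyFiniteMeasure (massShellMeasure n m) := by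
  have hc := continuous_energy (n := n) m
  refine IsLocallyFiniteMeasure.withDensity_ofReal ?_
  refine continuous_const.div (by fun_prop) fun p => ?_
  exact (mul_pos two_pos (energy_pos p)).ne'

theorem toLp_permSchwartz {k : ℕ} (σ : Equiv.Perm (Fin k)) (f : 𝓢(Fin k → Space n, ℂ)) :
    (permSchwartz σ f).toLp 2 (kMeasure n m k) =
      Lp.compMeasurePreservingₗᵢ ℂ _ (measurePreserving_perm n m k σ)
        (f.toLp 2 (kMeasure n m k)) := by
  change _ = Lp.compMeasurePreserving _ (measurePreserving_perm n m k σ)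
        ((f.memLp 2 (kMeasure n m k)).toLp)
  rw [Lp.toLp_compMeasurePreserving]
  rfl

/-- Permutations act by isometries that fix v, so all k! summands have the same inner product with
v. Testing v against symmetric functions is thus as good as testing it against all Schwartz
functions. -/
theorem inner_toLp_symmetrize {k : ℕ} (f : 𝓢(Fin k → Space n, ℂ)) (v : kParticleSpace n m k) :
    inner ℂ (toKParticle n m k (symmetrize f)) v =
      (Nat.factorial k : ℂ) * inner ℂ (f.toLp 2 (kMeasure n m k)) v.1 := by
  rw [Submodule.coe_inner, toKParticle_coe]
  have h : (symmetrize f).1.toLp 2 (kMeasure n m k) =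
      ∑ σ : Equiv.Perm (Fin k), (permSchwartz σ f).toLp 2 (kMeasure n m k) :=
    map_sum (SchwartzMap.toLpCLM ℂ ℂ 2 (kMeasure n m k)) _ _
  rw [h, sum_inner]
  have h2 : ∀ σ : Equiv.Perm (Fin k),
      inner ℂ ((permSchwartz σ f).toLp 2 (kMeasure n m k)) v.1 =
        inner ℂ (f.toLp 2 (kMeasure n m k)) v.1 := by
    intro σ
    rw [toLp_permSchwartz]
    nth_rewrite 1 [← v.2 σ]
    exact LinearIsometry.inner_map_map _ _ _
  simp only [h2, Finset.sum_const, Finset.card_univ, Fintype.card_perm, Fintype.card_fin,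
    nsmul_eq_mul]

/-- A vector of the Fock space is determined by its inner products with the domain. -/
theorem eq_of_inner_toFock {v w : Fock n m}
    (h : ∀ Φ : Dom n, inner ℂ (toFock m Φ) v = inner ℂ (toFock m Φ) w) : v = w := by
  rw [← sub_eq_zero]
  have h0 : ∀ Φ : Dom n, inner ℂ (toFock m Φ) (v - w) = 0 := fun Φ => by
    rw [inner_sub_right, h, sub_self]
  generalize v - w = u at h0
  refine Subtype.ext (funext fun k => Subtype.ext ?_)
  let u' : lp (fun k : ℕ => kParticleSpace n m k) 2 := u
  change (u' k).1 = 0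
  have hd := SchwartzMap.denseRange_toLpCLM (F := ℂ) (p := 2) (μ := kMeasure n m k)
    ENNReal.ofNat_ne_top
  refine hd.eq_zero_of_inner_right ℂ fun f => ?_
  have h1 := h0 (DFinsupp.single k (symmetrize f))
  have h2 := (inner_toFock_single_left (m := m) k (symmetrize f) u').symm.trans h1
  rw [inner_toLp_symmetrize] at h2
  exact (mul_eq_zero.1 h2).resolve_left (by exact_mod_cast k.factorial_ne_zero)

end Density

/-! ### Transfer to coordinate space. -/

section CoordinateSpace

variable {n : ℕ} {m : ℝ}

theorem spatialPairing_eq (p x : Space n) : spatialPairing m p x = -inner ℝ p x := by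
  simp only [spatialPairing, covMomentum, Fin.cons_succ, PiLp.inner_apply, ← Finset.sum_neg_distrib]
  refine Finset.sum_congr rfl fun i _ => ?_
  simp [mul_comm]

variable [hm : Fact (0 < m)]

theorem fourierIntegrand_eq (x : Space n) (Ψ : Dom n) (p : Space n) :
    fourierIntegrand m x Ψ p =
      Complex.exp (Complex.I * (inner ℝ p x : ℝ)) • annihilation m p Ψ := by
  rw [fourierIntegrand, spatialPairing_eq]
  push_cast
  rw [neg_mul_neg]

theorem coordAnnihilation_eq (x : Space n) (Ψ : Dom n) :
    coordAnnihilation m x Ψ = waveTransform (fun p => annihilation m p Ψ) x := by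
  rw [coordAnnihilation, waveTransform]
  simp only [fourierIntegrand_eq]

theorem differentiable_coordAnnihilation (Ψ : Dom n) :
    Differentiable ℝ (fun x : Space n => coordAnnihilation m x Ψ) := by
  have hr := rapidDecay_annihilation (m := m) Ψ
  simp only [coordAnnihilation_eq]
  exact fun x => (fderiv_waveTransform hr.integrable
    (by simpa using hr.integrable_pow_mul 1) x).1

theorem partialDeriv_coordAnnihilation (j : Fin n) (Ψ : Dom n) (x : Space n) :
    Complex.I • partialDeriv j (fun y => coordAnnihilation m y Ψ) x =
      waveTransform (fun p => (covMomentum m p j.succ : ℂ) • annihilation m p Ψ) x := by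
  have hr := rapidDecay_annihilation (m := m) Ψ
  simp only [coordAnnihilation_eq, partialDeriv]
  rw [(fderiv_waveTransform hr.integrable (by simpa using hr.integrable_pow_mul 1) x).2,
    ← waveTransform_const_smul]
  congr 1
  funext p
  rw [smul_smul, ← mul_assoc, Complex.I_mul_I]
  have hp : inner ℝ p (EuclideanSpace.single j (1 : ℝ)) = p j := by
    simp [EuclideanSpace.inner_single_right]
  rw [hp]
  simp [covMomentum]

/-- By unitarity of the wave transform, the coordinate integral equals the momentum integral. Both
coordinate representations are instances: only `B` has to be recognized as the transform of p_μ
a(p)Ψ. -/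
theorem isOperatorIntegral_of_waveTransform {μ : Fin (n + 1)} {B : Space n → Dom n → Fock n m}
    (hB : ∀ x Ψ, B x Ψ =
      waveTransform (fun p => (covMomentum m p μ : ℂ) • annihilation m p Ψ) x) :
    IsOperatorIntegral (momentumOperator m μ) (coordAnnihilation m) B := by
  intro Φ Ψ
  have h1 := rapidDecay_annihilation (m := m) Φ
  have h2 := rapidDecay_covMomentum_smul_annihilation (m := m) μ Ψ
  obtain ⟨h3, h4⟩ := integral_inner_waveTransform h1.integrable h1.memLp_two h2.integrable
    h2.memLp_two
  simp only [coordAnnihilation_eq, hB]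
  exact ⟨h3, (inner_momentumOperator μ Φ Ψ).trans h4.symm⟩

theorem isMomentumOperator_iff (μ : Fin (n + 1)) (T : Dom n →ₗ[ℂ] Fock n m) :
    IsMomentumOperator μ T ↔ T = momentumOperator m μ := by
  refine ⟨fun hT => LinearMap.ext fun Ψ => eq_of_inner_toFock fun Φ => ?_, ?_⟩
  · rw [(hT Φ Ψ).2, inner_momentumOperator]
  · rintro rfl
    exact isMomentumOperator_momentumOperator μ

end CoordinateSpace

end ScalarFock

end

theorem mainTheorem2 (n : ℕ) (hn : 1 ≤ n) (m : ℝ) [Fact (0 < m)] :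
    -- the coordinate space operators `ã(x)` are well defined and differentiable in `x`
    (∀ (x : Space n) (Ψ : Dom n), Integrable (fourierIntegrand m x Ψ)) ∧
    (∀ Ψ : Dom n, Differentiable ℝ (fun x : Space n => coordAnnihilation m x Ψ)) ∧
    ∃ P : Fin (n + 1) → (Dom n →ₗ[ℂ] Fock n m),
      -- `P μ` is the unique operator `∫ dⁿp p_μ a*(p) a(p)`
      (∀ (μ : Fin (n + 1)) (T : Dom n →ₗ[ℂ] Fock n m), IsMomentumOperator μ T ↔ T = P μ) ∧
      -- `P_0 = ∫ dⁿx ã*(x) (ω̃ ∗ ã)(x)`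
      (∃ conv : Space n → Dom n → Fock n m,
        (∀ (x : Space n) (Ψ : Dom n),
          HasConvolution (omegaTilde m) (fun y => coordAnnihilation m y Ψ) x (conv x Ψ)) ∧
        IsOperatorIntegral (P 0) (coordAnnihilation m) conv) ∧
      -- `P_j = i ∫ dⁿx ã*(x) ∂_j ã(x)`
      (∀ j : Fin n,
        IsOperatorIntegral (P j.succ)
          (coordAnnihilation m)
          (fun x Ψ => Complex.I • partialDeriv j (fun y => coordAnnihilation m y Ψ) x)) := by
  refine ⟨fun x Ψ => ?_, differentiable_coordAnnihilation, momentumOperator m,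
    isMomentumOperator_iff, ⟨fun x Ψ => waveTransform
      (fun p => (energy m p : ℂ) • annihilation m p Ψ) x, fun x Ψ => ?_,
      -- `rfl` suffices because `covMomentum m p 0` reduces to `energy m p`.
      isOperatorIntegral_of_waveTransform fun x Ψ => rfl⟩,
    fun j => isOperatorIntegral_of_waveTransform fun x Ψ => partialDeriv_coordAnnihilation j Ψ x⟩
  · simp only [funext (fourierIntegrand_eq x Ψ)]
    exact integrable_planeWave_smul (rapidDecay_annihilation Ψ).integrable x
  · have hr := rapidDecay_annihilation (m := m) Ψ
    simp only [coordAnnihilation_eq]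
    exact hasConvolution_waveTransform hn Fact.out hr.integrable (hr.integrable_pow_mul 2) x
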